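/- Setting. Let $\Omega\subset\mathbb{R}^d$ be compact, let $\mathsf m$ be a Borel measure on $\Omega$ (for instance Lebesgue or surface measure) and let $\mathsf w\ge 0$ be a measurable weight on $\Omega$ with $\int_\Omega \mathsf w\,d\mathsf m=1$. Let $\Pi_n(\Omega)$ be the space of restrictions to $\Omega$ of real polynomials of degree at most $n$, and assume that $\langle f,g\rangle_{\mathsf w}=\int_\Omega f g\,\mathsf w\,d\mathsf m$ is an inner product on polynomials restricted to $\Omega$ (i.e. $\langle p,p\rangle_{\mathsf w}=0$ only if $p=0$ on $\Omega$). Let $\mathcal V_n$ be the space of $p\in\Pi_n(\Omega)$ that are orthogonal to $\Pi_{n-1}(\Omega)$ (with $\Pi_{-1}=\{0\}$), let $$P_n(x,y)=\sum_k \frac{P^n_k(x)P^n_k(y)}{\langle P^n_k,P^n_k\rangle_{\mathsf w}}$$ be its reproducing kernel, where $\{P_k^n\}_k$ is an orthogonal basis of $\mathcal V_n$, and for $f\in L^1(\Omega,\mathsf w)$ put $\operatorname{proj}_n(f,x)=\int_\Omega f(y)P_n(x,y)\,\mathsf w(y)\,d\mathsf m(y)$. Let $P_n^{(\alpha,\beta)}$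 be the Jacobi polynomials, with $P_n^{(\alpha,\beta)}(1)=\binom{n+\alpha}{n}$, let $h_n^{(\alpha,\beta)}=\frac{(\alpha+1)_n(\beta+1)_n(\alpha+\beta+n+1)}{n!\,(\alpha+\beta+2)_n(\alpha+\beta+2n+1)}$ (with $h_0^{(\alpha,\beta)}=1$) be the square of their norm with respect to the normalized Jacobi weight on $[-1,1]$, and let $Z_n^{(\alpha,\beta)}(t)=P_n^{(\alpha,\beta)}(1)P_n^{(\alpha,\beta)}(t)/h_n^{(\alpha,\beta)}$. Assume that $\mathsf w$ admits an addition formula: there are $\alpha\ge\beta\ge-\frac12$, an integer $m\ge1$, a Borel probability measure $\tau$ on $[-1,1]^m$ and a function $\xi(x,y;u)\in[-1,1]$ ($x,y\in\Omega$, $u\in[-1,1]^m$), symmetric in $x,y$ and measurable in $u$, such that $$P_n(x,y)=\int_{[-1,1]^m}Z_n^{(\alpha,\beta)}\big(\xi(x,y;u)\big)\,d\tau(u)\qquad\text{for all } n\ge0,\ x,y\in\Omega.$$ For $0\le r<1$ and $f\in L^1(\Omega,\mathsf w)$ define the Poisson integral $Q_r(\mathsf w;f,x)=\sum_{n=0}^\infty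 \operatorname{proj}_n(f,x)\,r^n$. Theorem. The series defining $Q_r(\mathsf w;f,x)$ converges absolutely for every $f\in L^1(\Omega,\mathsf w)$, $0\le r<1$ and $x\in\Omega$, and for all $0\le r<1$: 1. $Q_r(\mathsf w;1)=1$ on $\Omega$. 2. If $f\in L^1(\Omega,\mathsf w)$ and $f\ge0$ almost everywhere, then $Q_r(\mathsf w;f,x)\ge0$ for every $x\in\Omega$. 3. $Q_r(\mathsf w)$ is a bounded self-adjoint operator on $L^2(\Omega,\mathsf w)$. 4. $\|Q_r(\mathsf w;f)\|_{p}\le\|f\|_{p}$ for $f\in L^p(\Omega,\mathsf w)$, $1\le p\le\infty$; moreover, if $f\in C(\Omega)$ then $Q_r(\mathsf w;f)\in C(\Omega)$ and the same bound holds for the uniform norm. 5. If $1\le p<\infty$ and $f\in L^p(\Omega,\mathsf w)$, then $\|Q_r(\mathsf w;f)-f\|_{p}\to0$ as $r\to1-$; if $f\in C(\Omega)$, then $Q_r(\mathsf w;f)\to f$ uniformly on $\Omega$ as $r\to1-$. -/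

import Mathlib

open MeasureTheory Set Filter Topology
open scoped ENNReal

noncomputable section

namespace PoissonAdd

/-! ## Jacobi polynomials -/

/-- The Pochhammer symbol `(a)_k = a (a+1) ⋯ (a+k-1)`. -/
def poch (a : ℝ) (k : ℕ) : ℝ := ∏ j ∈ Finset.range k, (a + j)

/-- The Jacobi polynomial `P_n^{(α,β)}(t) = ((α+1)_n / n!) ₂F₁(-n, n+α+β+1; α+1; (1-t)/2)`,
written out as a polynomial in `(t-1)/2`; it satisfies `P_n^{(α,β)}(1) = (α+1)_n / n!`, which is
the binomial coefficient `n + α` over `n`. -/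
def jacobiP (α β : ℝ) (n : ℕ) (t : ℝ) : ℝ :=
  (1 / (n.factorial : ℝ)) * ∑ k ∈ Finset.range (n + 1),
    (n.choose k : ℝ) * poch (n + α + β + 1) k * poch (α + k + 1) (n - k) * ((t - 1) / 2) ^ k

/-- The squared norm `h_n^{(α,β)}` of `P_n^{(α,β)}` for the normalized Jacobi weight
`c'_{α,β} (1-t)^α (1+t)^β` on `[-1,1]`, in closed form. The case `n = 0` (where `P_0 = 1`) is
separate because the quotient reads `0/0` there when `α + β = -1`. -/
def jacobiH (α β : ℝ) (n : ℕ) : ℝ :=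
  if n = 0 then 1 else
    poch (α + 1) n * poch (β + 1) n * (α + β + n + 1) /
      ((n.factorial : ℝ) * poch (α + β + 2) n * (α + β + 2 * n + 1))

/-- `Z_n^{(α,β)}(t) = P_n^{(α,β)}(1) P_n^{(α,β)}(t) / h_n^{(α,β)}`. -/
def jacobiZ (α β : ℝ) (n : ℕ) (t : ℝ) : ℝ :=
  jacobiP α β n 1 * jacobiP α β n t / jacobiH α β n

/-! ## Orthogonal polynomials on a compact set -/

/-- The measure `𝗐 d𝗆`. -/
def weightMeasure {X : Type*} [MeasurableSpace X] (m : Measure X) (w : X → ℝ) : Measure X :=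
  m.withDensity fun x => ENNReal.ofReal (w x)

section

variable {d : ℕ} {Ω : Set (EuclideanSpace ℝ (Fin d))}

/-- Restriction to `Ω` of a real polynomial in `d` variables. -/
def restrictPoly (Ω : Set (EuclideanSpace ℝ (Fin d))) :
    MvPolynomial (Fin d) ℝ →ₗ[ℝ] C(Ω, ℝ) where
  toFun p := ⟨fun x => MvPolynomial.eval (fun i => (x : EuclideanSpace ℝ (Fin d)) i) p, by
    have h := MvPolynomial.continuous_eval p
    exact h.comp (by fun_prop)⟩
  map_add' p q := by ext x; simp
  map_smul' c p := by ext x; simp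

/-- `Π_n(Ω)`: the restrictions to `Ω` of the polynomials of total degree at most `n`. -/
def polySpace (Ω : Set (EuclideanSpace ℝ (Fin d))) (n : ℕ) : Submodule ℝ C(Ω, ℝ) :=
  (MvPolynomial.restrictTotalDegree (Fin d) ℝ n).map (restrictPoly Ω)

variable [CompactSpace Ω]

theorem integrable_cont (μ : Measure Ω) [IsFiniteMeasure μ] (f : C(Ω, ℝ)) : Integrable f μ :=
  f.continuous.integrable_of_hasCompactSupport (HasCompactSupport.of_compactSpace f)

/-- The form `⟨f, g⟩ = ∫ f g dμ` on continuous functions. -/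
def innerForm (μ : Measure Ω) [IsFiniteMeasure μ] : LinearMap.BilinForm ℝ C(Ω, ℝ) :=
  LinearMap.mk₂ ℝ (fun f g => ∫ x, f x * g x ∂μ)
    (fun f f' g => by
      have h := integral_add (integrable_cont μ (f * g)) (integrable_cont μ (f' * g))
      simpa [add_mul] using h)
    (fun c f g => by simp [mul_assoc, integral_const_mul])
    (fun f g g' => by
      have h := integral_add (integrable_cont μ (f * g)) (integrable_cont μ (f * g'))
      simpa [mul_add] using h)
    (fun c f g => by simp [mul_left_comm, integral_const_mul])

/-- `𝒱_n(Ω, μ)`: the elements of `Π_n(Ω)` orthogonal to all `q ∈ Π_k(Ω)`, `k < n`. -/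
def orthoSpace (μ : Measure Ω) [IsFiniteMeasure μ] (n : ℕ) : Submodule ℝ C(Ω, ℝ) where
  carrier := {p | p ∈ polySpace Ω n ∧ ∀ k < n, ∀ q ∈ polySpace Ω k, innerForm μ p q = 0}
  add_mem' := fun {a b} ha hb => ⟨add_mem ha.1 hb.1, fun k hk q hq => by
    simp [ha.2 k hk q hq, hb.2 k hk q hq]⟩
  zero_mem' := ⟨zero_mem _, fun k hk q hq => by simp⟩
  smul_mem' := fun c a ha => ⟨Submodule.smul_mem _ c ha.1, fun k hk q hq => by
    simp [ha.2 k hk q hq]⟩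

instance finite_orthoSpace (μ : Measure Ω) [IsFiniteMeasure μ] (n : ℕ) :
    FiniteDimensional ℝ (orthoSpace μ n) := by
  have : FiniteDimensional ℝ (polySpace Ω n) := by unfold polySpace; infer_instance
  have hle : orthoSpace μ n ≤ polySpace Ω n := fun p hp => hp.1
  exact Submodule.finiteDimensional_of_le hle

theorem exists_ortho_basis (μ : Measure Ω) [IsFiniteMeasure μ] (n : ℕ) :
    ∃ P : Module.Basis (Fin (Module.finrank ℝ (orthoSpace μ n))) ℝ (orthoSpace μ n),
      ∀ j k, j ≠ k → innerForm μ (P j) (P k) = 0 := by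
  let B : LinearMap.BilinForm ℝ (orthoSpace μ n) := (innerForm μ).restrict (orthoSpace μ n)
  have : Invertible (2 : ℝ) := invertibleOfNonzero two_ne_zero
  have hs : LinearMap.IsSymm B := ⟨fun p q => by
    change ∫ x, (p : C(Ω, ℝ)) x * (q : C(Ω, ℝ)) x ∂μ = ∫ x, (q : C(Ω, ℝ)) x * (p : C(Ω, ℝ)) x ∂μ
    simp [mul_comm]⟩
  obtain ⟨v, hv⟩ := LinearMap.BilinForm.exists_orthogonal_basis hs
  exact ⟨v, fun j k hjk => hv hjk⟩

/-- An orthogonal basis `P_1^n, …, P_N^n`, `N = dim 𝒱_n`, of `𝒱_n(Ω, μ)`. -/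
def orthoBasis (μ : Measure Ω) [IsFiniteMeasure μ] (n : ℕ) :
    Module.Basis (Fin (Module.finrank ℝ (orthoSpace μ n))) ℝ (orthoSpace μ n) :=
  (exists_ortho_basis μ n).choose

/-- The reproducing kernel `P_n(x, y) = ∑_k P_k^n(x) P_k^n(y) / ⟨P_k^n, P_k^n⟩` of `𝒱_n(Ω, μ)`
(it does not depend on the choice of the orthogonal basis). -/
def reproKernel (μ : Measure Ω) [IsFiniteMeasure μ] (n : ℕ) (x y : Ω) : ℝ :=
  ∑ k, (orthoBasis μ n k : C(Ω, ℝ)) x * (orthoBasis μ n k : C(Ω, ℝ)) y /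
    innerForm μ (orthoBasis μ n k) (orthoBasis μ n k)

/-- `proj_n(f, x) = ∫ f(y) P_n(x, y) dμ(y)`. -/
def projOp (μ : Measure Ω) [IsFiniteMeasure μ] (n : ℕ) (f : Ω → ℝ) (x : Ω) : ℝ :=
  ∫ y, f y * reproKernel μ n x y ∂μ

/-- The Poisson integral `Q_r(f, x) = ∑_{n ≥ 0} proj_n(f, x) r^n`. -/
def poissonInt (μ : Measure Ω) [IsFiniteMeasure μ] (r : ℝ) (f : Ω → ℝ) (x : Ω) : ℝ :=
  ∑' n : ℕ, projOp μ n f x * r ^ n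

/-- The integral form `⟨p, q⟩ = ∫ p q dμ` is an inner product (is definite) on the space of
polynomials restricted to `Ω`. -/
def IsInnerOnPoly (μ : Measure Ω) [IsFiniteMeasure μ] : Prop :=
  ∀ n, ∀ p ∈ polySpace Ω n, innerForm μ p p = 0 → p = 0

/-- The reproducing kernels of `𝒱_n(Ω, μ)`, `n ≥ 0`, satisfy an addition formula: for some
`α ≥ β ≥ -1/2`, some `m ≥ 1`, some probability measure `τ` on `[-1,1]^m` and some
`ξ(x, y; u) ∈ [-1,1]`, symmetric in `x` and `y` and measurable in `u`,
`P_n(x, y) = ∫ Z_n^{(α,β)}(ξ(x, y; u)) dτ(u)` for all `n`, `x`, `y`. -/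
def AdditionFormula (μ : Measure Ω) [IsFiniteMeasure μ] : Prop :=
  ∃ α β : ℝ, -(1 / 2) ≤ β ∧ β ≤ α ∧
  ∃ m : ℕ, 0 < m ∧
  ∃ (τ : Measure (Fin m → Icc (-1 : ℝ) 1)) (ξ : Ω → Ω → (Fin m → Icc (-1 : ℝ) 1) → ℝ),
    IsProbabilityMeasure τ ∧
    (∀ x y u, ξ x y u = ξ y x u) ∧
    (∀ x y u, ξ x y u ∈ Icc (-1 : ℝ) 1) ∧
    (∀ x y, AEMeasurable (ξ x y) τ) ∧
    ∀ n x y, reproKernel μ n x y = ∫ u, jacobiZ α β n (ξ x y u) ∂τ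

end

end PoissonAdd

end

open PoissonAdd

noncomputable section

namespace PoissonAdd

/-! ### Pochhammer symbols -/

/-! Everything reduces to one fact: for `0 ≤ r < 1` the Poisson kernel `K_r(x, y) = ∑ P_n(x, y) r^n`
is continuous, symmetric, nonnegative and of total mass one. An integral operator with such a kernel
preserves positivity, is symmetric on `L²`, and contracts every `L^p` (Jensen for the probability
measures `K_r(x, ·) dμ`, then Tonelli) as well as the uniform norm. Mass one holds because `proj_0 1
= 1` and `proj_n 1 = 0` for `n ≥ 1`.

The addition formula transfers the other properties from two facts about Jacobi polynomials. Growth: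
`|Z_n(t)| ≤ Z_n(1)` on `[-1,1]` (`abs_jacobiZ_le`, by Sonin's argument), and `∑ Z_n(1) r^n`
converges. This dominates all series and allows every exchange of sum and integral. Positivity: with
`x = (1 + t)/2` and `s = α + β + 2`, `∑ Z_n(t) r^n = (1 - r) (1 + r)^(-s) ∑_k (s)_{2k} / ((β+1)_k
k!) (x r / (1 + r)²)^k`, and every factor on the right is nonnegative (`tsum_jacobiZ`). The identity
is proved for small `r` by rearranging a double series and extended to `r < 1` by analyticity. It
needs the expansion of `Z_n` in powers of `(1 + t)/2`, which comes from the hypergeometric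
differential equation.

As `r → 1`, convergence is clear on polynomials, where the Poisson integral is a finite sum. The
uniform bounds and density (Stone–Weierstrass, then continuous functions in `L^p`) give the general
case. -/

theorem poch_zero (a : ℝ) : poch a 0 = 1 := by simp [poch]

theorem poch_succ (a : ℝ) (k : ℕ) : poch a (k + 1) = poch a k * (a + k) := by
  simp [poch, Finset.prod_range_succ]

theorem poch_succ' (a : ℝ) (k : ℕ) : poch a (k + 1) = a * poch (a + 1) k := by
  simp only [poch, Finset.prod_range_succ']
  rw [mul_comm]
  simp only [Nat.cast_zero, add_zero, Nat.cast_add, Nat.cast_one]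
  congr 1
  exact Finset.prod_congr rfl fun j _ => by ring

theorem poch_add (a : ℝ) (m n : ℕ) : poch a (m + n) = poch a m * poch (a + m) n := by
  induction n with
  | zero => simp [poch_zero]
  | succ n ih => rw [← add_assoc, poch_succ, poch_succ, ih]; push_cast; ring

theorem poch_pos {a : ℝ} (ha : 0 < a) (k : ℕ) : 0 < poch a k :=
  Finset.prod_pos fun j _ => by positivity

theorem poch_mono {a b : ℝ} (ha : 0 ≤ a) (hab : a ≤ b) (k : ℕ) : poch a k ≤ poch b k :=
  Finset.prod_le_prod (fun j _ => by positivity) fun j _ => by linarith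

/-! ### The hypergeometric differential operator on polynomials -/

open Polynomial in
/-- The operator `p ↦ X² p'' + e X p'' + s X p' + g p' - l p`. -/
def hypergeomOp (e s g l : ℝ) (p : ℝ[X]) : ℝ[X] :=
  X ^ 2 * derivative (derivative p) + C e * (X * derivative (derivative p)) +
    C s * (X * derivative p) + C g * derivative p - C l * p

-- The operator sends `X^k` to a combination of `X^k` and `X^(k-1)`, so the differential equation is
-- a two-term recursion for the coefficients.
open Polynomial in
theorem coeff_hypergeomOp (e s g l : ℝ) (p : ℝ[X]) (k : ℕ) :
    (hypergeomOp e s g l p).coeff k =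
      (k * (k - 1) + s * k - l) * p.coeff k + (k + 1) * (e * k + g) * p.coeff (k + 1) := by
  have h1 : ∀ q : ℝ[X], (X * derivative q).coeff k = k * q.coeff k := fun q => by
    cases k with
    | zero => simp
    | succ k => simp [coeff_X_mul, coeff_derivative, mul_comm]
  have h2 : (X ^ 2 * derivative (derivative p)).coeff k = k * (k - 1) * p.coeff k := by
    match k with
    | 0 => simp
    | 1 => simp [pow_two, mul_assoc, coeff_X_mul]
    | k + 2 =>
      rw [coeff_X_pow_mul]
      simp only [coeff_derivative]
      push_cast; ring
  simp only [hypergeomOp, coeff_add, coeff_sub, coeff_C_mul, h1, h2, coeff_derivative]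
  ring

-- With `X = Y - 1` one has `X² + X = Y² - Y` and `s X + g = s Y + (g - s)`. This moves the Jacobi
-- equation from the endpoint `t = 1` to `t = -1`.
open Polynomial in
theorem hypergeomOp_comp_sub_one (s g l : ℝ) (p : ℝ[X]) :
    hypergeomOp (-1) s (g - s) l (p.comp (X - C 1)) =
      (hypergeomOp 1 s g l p).comp (X - C 1) := by
  simp only [hypergeomOp, derivative_comp, sub_comp, add_comp, mul_comp, C_comp,
    X_comp, pow_comp, derivative_sub, derivative_X, sub_zero, C_1, C_sub, C_neg,
    one_mul, derivative_one]
  ring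

/-! ### Jacobi polynomials in the variables `(t - 1) / 2` and `(1 + t) / 2` -/

/-- The coefficients of the Jacobi polynomial in powers of `(t - 1) / 2`. -/
def jacobiCoeff (α β : ℝ) (n k : ℕ) : ℝ :=
  (1 / (n.factorial : ℝ)) *
    ((n.choose k : ℝ) * poch (n + α + β + 1) k * poch (α + k + 1) (n - k))

open Polynomial in
/-- The Jacobi polynomial in the variable `(t - 1) / 2`. -/
def jacobiPoly (α β : ℝ) (n : ℕ) : ℝ[X] :=
  ∑ k ∈ Finset.range (n + 1), C (jacobiCoeff α β n k) * X ^ k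

theorem eval_jacobiPoly (α β : ℝ) (n : ℕ) (t : ℝ) :
    (jacobiPoly α β n).eval ((t - 1) / 2) = jacobiP α β n t := by
  simp [jacobiPoly, jacobiP, Polynomial.eval_finsetSum, jacobiCoeff, Finset.mul_sum, mul_assoc]

theorem coeff_jacobiPoly (α β : ℝ) (n k : ℕ) :
    (jacobiPoly α β n).coeff k = jacobiCoeff α β n k := by
  simp only [jacobiPoly, Polynomial.finsetSum_coeff, Polynomial.coeff_C_mul_X_pow]
  rw [Finset.sum_ite_eq]
  split_ifs with h
  · rfl
  · rw [jacobiCoeff, Nat.choose_eq_zero_of_lt (by simpa using h)]; simp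

theorem jacobiCoeff_rec (α β : ℝ) (n k : ℕ) :
    ((n : ℝ) - k) * (n + k + (α + β + 1)) * jacobiCoeff α β n k =
      (k + 1) * (k + α + 1) * jacobiCoeff α β n (k + 1) := by
  rcases lt_trichotomy k n with h | rfl | h
  · obtain ⟨j, rfl⟩ : ∃ j, n = k + 1 + j := ⟨n - (k + 1), by omega⟩
    have h1 := Nat.choose_succ_right_eq (k + 1 + j) k
    have h2 : k + 1 + j - k = j + 1 := by omega
    have h3 : k + 1 + j - (k + 1) = j := by omega
    rw [h2] at h1
    have h1' : ((k + 1 + j).choose (k + 1) : ℝ) * (k + 1) = (k + 1 + j).choose k * (j + 1) := by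
      exact_mod_cast h1
    simp only [jacobiCoeff, h2, h3, poch_succ' _ j, poch_succ _ k]
    rw [show α + (k : ℝ) + 1 + 1 = α + ((k + 1 : ℕ) : ℝ) + 1 by push_cast; ring]
    generalize poch (α + ((k + 1 : ℕ) : ℝ) + 1) j = u
    generalize poch (((k + 1 + j : ℕ) : ℝ) + α + β + 1) k = v
    push_cast
    linear_combination -(1 / ((k + 1 + j).factorial : ℝ)) * v * u * (k + α + 1) *
      (k + 1 + j + α + β + 1 + k) * h1'
  · simp [jacobiCoeff, Nat.choose_succ_self]
  · simp [jacobiCoeff, Nat.choose_eq_zero_of_lt h, Nat.choose_eq_zero_of_lt (h.trans k.lt_succ_self)]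

theorem hypergeomOp_jacobiPoly (α β : ℝ) (n : ℕ) :
    hypergeomOp 1 (α + β + 2) (α + 1) (n * (n + (α + β + 1))) (jacobiPoly α β n) = 0 := by
  ext k
  rw [coeff_hypergeomOp, coeff_jacobiPoly, coeff_jacobiPoly, Polynomial.coeff_zero]
  linear_combination -jacobiCoeff_rec α β n k

open Polynomial in
/-- The Jacobi polynomial in the variable `(1 + t) / 2`. -/
def jacobiPoly' (α β : ℝ) (n : ℕ) : ℝ[X] := (jacobiPoly α β n).comp (X - C 1)

theorem hypergeomOp_jacobiPoly' (α β : ℝ) (n : ℕ) :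
    hypergeomOp (-1) (α + β + 2) (-(β + 1)) (n * (n + (α + β + 1))) (jacobiPoly' α β n) = 0 := by
  have h := hypergeomOp_comp_sub_one (α + β + 2) (α + 1) (n * (n + (α + β + 1))) (jacobiPoly α β n)
  rw [hypergeomOp_jacobiPoly, Polynomial.zero_comp] at h
  rw [← h, jacobiPoly']
  congr 1; ring

theorem eval_jacobiPoly' (α β : ℝ) (n : ℕ) (t : ℝ) :
    (jacobiPoly' α β n).eval ((1 + t) / 2) = jacobiP α β n t := by
  rw [jacobiPoly', Polynomial.eval_comp, ← eval_jacobiPoly]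
  congr 1; simp; ring

theorem coeff_jacobiPoly'_rec (α β : ℝ) (n k : ℕ) :
    ((k : ℝ) - n) * (n + k + (α + β + 1)) * (jacobiPoly' α β n).coeff k =
      (k + 1) * (k + β + 1) * (jacobiPoly' α β n).coeff (k + 1) := by
  have h := congrArg (fun p => Polynomial.coeff p k) (hypergeomOp_jacobiPoly' α β n)
  simp only [coeff_hypergeomOp, Polynomial.coeff_zero] at h
  linear_combination h

theorem natDegree_jacobiPoly_le (α β : ℝ) (n : ℕ) : (jacobiPoly α β n).natDegree ≤ n :=
  Polynomial.natDegree_le_iff_coeff_eq_zero.2 fun k hk => by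
    rw [coeff_jacobiPoly, jacobiCoeff, Nat.choose_eq_zero_of_lt hk]; simp

theorem coeff_jacobiPoly'_self (α β : ℝ) (n : ℕ) :
    (jacobiPoly' α β n).coeff n = jacobiCoeff α β n n := by
  have h := Polynomial.coeff_comp_degree_mul_degree (p := jacobiPoly α β n)
    (q := Polynomial.X - Polynomial.C 1) (by rw [Polynomial.natDegree_X_sub_C]; exact one_ne_zero)
  by_cases hn : (jacobiPoly α β n).natDegree = n
  · rw [Polynomial.natDegree_X_sub_C, mul_one, hn] at h
    rw [jacobiPoly', h, ← coeff_jacobiPoly, Polynomial.leadingCoeff, hn,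
      Polynomial.leadingCoeff_X_sub_C, one_pow, mul_one]
  -- If the top coefficient vanishes, the degree drops below `n` and both sides are zero.
  · have hlt : (jacobiPoly α β n).natDegree < n := lt_of_le_of_ne (natDegree_jacobiPoly_le α β n) hn
    rw [← coeff_jacobiPoly, Polynomial.coeff_eq_zero_of_natDegree_lt hlt, jacobiPoly']
    apply Polynomial.coeff_eq_zero_of_natDegree_lt
    rwa [Polynomial.natDegree_comp, Polynomial.natDegree_X_sub_C, mul_one]

theorem natDegree_jacobiPoly'_le (α β : ℝ) (n : ℕ) : (jacobiPoly' α β n).natDegree ≤ n := by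
  rw [jacobiPoly', Polynomial.natDegree_comp, Polynomial.natDegree_X_sub_C, mul_one]
  exact natDegree_jacobiPoly_le α β n

/-- The coefficients of `Z_n^{(α,β)}` in powers of `(1 + t) / 2`, for `n = N + 1`. -/
def zonalCoeff (α β : ℝ) (N k : ℕ) : ℝ :=
  (-1) ^ (N + 1 - k) * (α + β + 1 + 2 * (N + 1)) * poch (α + β + 2) (N + k) /
    (poch (β + 1) k * k.factorial * (N + 1 - k).factorial)

/-- The factor `P_n(1) / h_n`, for `n = N + 1`. -/
def zonalFactor (α β : ℝ) (N : ℕ) : ℝ :=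
  poch (α + β + 2) N * (α + β + 1 + 2 * (N + 1)) / poch (β + 1) (N + 1)

theorem jacobiP_one (α β : ℝ) (n : ℕ) : jacobiP α β n 1 = poch (α + 1) n / n.factorial := by
  have h := eval_jacobiPoly α β n 1
  rw [sub_self, zero_div, ← Polynomial.coeff_zero_eq_eval_zero, coeff_jacobiPoly] at h
  rw [← h, jacobiCoeff]
  simp [poch_zero]; ring

/-- The factor `α + β + n + 1` of `h_n` cancels against the last factor of `(α+β+2)_n`. Writing `n =
N + 1` keeps every denominator nonzero, including when `α + β = -1`. -/
theorem jacobiP_one_div_jacobiH {α β : ℝ} (hβ : -(1 / 2) ≤ β) (hαβ : β ≤ α) (N : ℕ) :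
    jacobiP α β (N + 1) 1 / jacobiH α β (N + 1) = zonalFactor α β N := by
  rw [jacobiP_one, jacobiH, if_neg (by omega), zonalFactor, poch_succ (α + β + 2) N]
  have h1 := (poch_pos (a := α + 1) (by linarith) (N + 1)).ne'
  have h2 := (poch_pos (a := β + 1) (by linarith) (N + 1)).ne'
  have h3 := (poch_pos (a := α + β + 2) (by linarith) N).ne'
  have h4 : ((N + 1).factorial : ℝ) ≠ 0 := by positivity
  have hN : (0 : ℝ) ≤ N := by positivity
  have h5 : α + β + 2 + N ≠ 0 := by linarith
  have h6 : α + β + 2 * ((N + 1 : ℕ) : ℝ) + 1 ≠ 0 := by push_cast; linarith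
  have h7 : α + β + ((N + 1 : ℕ) : ℝ) + 1 ≠ 0 := by push_cast; linarith
  field_simp
  push_cast
  ring

theorem zonalFactor_mul_coeff_self {α β : ℝ} (hβ : -(1 / 2) ≤ β) (N : ℕ) :
    zonalFactor α β N * jacobiCoeff α β (N + 1) (N + 1) = zonalCoeff α β N (N + 1) := by
  have h2 := (poch_pos (a := β + 1) (by linarith) (N + 1)).ne'
  have h4 : ((N + 1).factorial : ℝ) ≠ 0 := by positivity
  rw [zonalFactor, jacobiCoeff, zonalCoeff, poch_add (α + β + 2)]
  simp only [Nat.choose_self, Nat.sub_self, poch_zero, pow_zero, Nat.factorial_zero]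
  rw [show ((N + 1 : ℕ) : ℝ) + α + β + 1 = α + β + 2 + N by push_cast; ring]
  field_simp
  simp

theorem zonalCoeff_rec {α β : ℝ} (hβ : -(1 / 2) ≤ β) {N k : ℕ} (hk : k ≤ N) :
    ((k : ℝ) - (N + 1)) * (N + 1 + k + (α + β + 1)) * zonalCoeff α β N k =
      (k + 1) * (k + β + 1) * zonalCoeff α β N (k + 1) := by
  obtain ⟨j, rfl⟩ : ∃ j, N = k + j := ⟨N - k, by omega⟩
  have h1 : k + j + 1 - k = j + 1 := by omega
  have h2 : k + j + 1 - (k + 1) = j := by omega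
  have h3 := (poch_pos (a := β + 1) (by linarith) k).ne'
  have h4 : β + 1 + k ≠ 0 := by
    have : (0 : ℝ) ≤ k := by positivity
    linarith
  have h5 : (k.factorial : ℝ) ≠ 0 := by positivity
  have h6 : (j.factorial : ℝ) ≠ 0 := by positivity
  rw [zonalCoeff, zonalCoeff, h1, h2, ← add_assoc (k + j), poch_succ, poch_succ, Nat.factorial_succ,
    Nat.factorial_succ]
  push_cast
  field_simp
  ring

/-- Both sides satisfy the same recursion and agree at `k = N + 1`, because translation preserves
the top coefficient. The induction descends: the multiplier `(k - n)(n + k + α + β + 1)` is nonzero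
for `k < n`. -/
theorem zonalFactor_mul_coeff {α β : ℝ} (hβ : -(1 / 2) ≤ β) (hαβ : β ≤ α) {N k : ℕ} (hk : k ≤ N + 1) :
    zonalFactor α β N * (jacobiPoly' α β (N + 1)).coeff k = zonalCoeff α β N k := by
  induction hk using Nat.decreasingInduction with
  | self => rw [coeff_jacobiPoly'_self, zonalFactor_mul_coeff_self hβ]
  | of_succ k hk ih =>
    have hk' : (k : ℝ) ≤ N := by exact_mod_cast Nat.lt_succ_iff.1 hk
    have hk0 : (0 : ℝ) ≤ k := by positivity
    have h1 := coeff_jacobiPoly'_rec α β (N + 1) k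
    have h2 := zonalCoeff_rec (α := α) hβ (Nat.lt_succ_iff.1 hk)
    have h3 : ((k : ℝ) - (N + 1)) * (N + 1 + k + (α + β + 1)) ≠ 0 :=
      mul_ne_zero (by linarith) (by linarith)
    apply mul_left_cancel₀ h3
    rw [h2, ← ih]
    push_cast at h1
    linear_combination zonalFactor α β N * h1

theorem jacobiZ_succ_eq_sum {α β : ℝ} (hβ : -(1 / 2) ≤ β) (hαβ : β ≤ α) (N : ℕ) (t : ℝ) :
    jacobiZ α β (N + 1) t =
      ∑ k ∈ Finset.range (N + 2), zonalCoeff α β N k * ((1 + t) / 2) ^ k := by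
  rw [jacobiZ, mul_div_right_comm, jacobiP_one_div_jacobiH hβ hαβ, ← eval_jacobiPoly',
    Polynomial.eval_eq_sum_range' (n := N + 2)
      (Nat.lt_succ_of_le (natDegree_jacobiPoly'_le α β (N + 1))), Finset.mul_sum]
  refine Finset.sum_congr rfl fun k hk => ?_
  rw [← zonalFactor_mul_coeff hβ hαβ (by simpa [Nat.lt_succ_iff] using hk)]
  ring

theorem jacobiZ_zero (α β t : ℝ) : jacobiZ α β 0 t = 1 := by
  simp [jacobiZ, jacobiP, jacobiH, poch_zero]

/-! ### Sonin's estimate -/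

/-- Sonin's function `S = p² + x(1-x) p'² / l` dominates `p²` and equals it at `0` and `1`. By the
differential equation `S' = (p'²/l)(2cx - (2b+1))`, and since `c ≥ 0` its sign can only change from
minus to plus. Hence `S` is largest at an endpoint. -/
theorem sonin_bound {p : Polynomial ℝ} {b c l B : ℝ} (hl : 0 < l) (hc : 0 ≤ c)
    (h : hypergeomOp (-1) (c + 1) (-(b + 1)) l p = 0)
    (h0 : |p.eval 0| ≤ B) (h1 : |p.eval 1| ≤ B) {x : ℝ} (hx : x ∈ Icc (0 : ℝ) 1) :
    |p.eval x| ≤ B := by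
  set S : Polynomial ℝ := p ^ 2 + Polynomial.C (1 / l) *
    (Polynomial.X * (1 - Polynomial.X) * (Polynomial.derivative p) ^ 2) with hS
  have hS' : ∀ y, S.derivative.eval y =
      (p.derivative.eval y) ^ 2 / l * (2 * c * y - (2 * b + 1)) := fun y => by
    have hy := congrArg (Polynomial.eval y) h
    simp only [hypergeomOp, Polynomial.eval_add, Polynomial.eval_sub, Polynomial.eval_mul,
      Polynomial.eval_pow, Polynomial.eval_X, Polynomial.eval_C, Polynomial.eval_zero] at hy
    simp only [hS, Polynomial.derivative_add, Polynomial.derivative_mul, Polynomial.derivative_pow,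
      Polynomial.derivative_sub, Polynomial.derivative_X, Polynomial.derivative_C,
      Polynomial.derivative_one, Polynomial.eval_add, Polynomial.eval_sub, Polynomial.eval_mul,
      Polynomial.eval_pow, Polynomial.eval_X, Polynomial.eval_C, Polynomial.eval_one,
      Polynomial.eval_zero]
    norm_num
    field_simp
    linear_combination (-2 * p.derivative.eval y) * hy
  have hB : 0 ≤ B := (abs_nonneg _).trans h0
  have hS0 : S.eval 0 ≤ B ^ 2 := by
    simpa [hS] using sq_le_sq' (abs_le.1 h0).1 (abs_le.1 h0).2
  have hS1 : S.eval 1 ≤ B ^ 2 := by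
    simpa [hS] using sq_le_sq' (abs_le.1 h1).1 (abs_le.1 h1).2
  have hle : (p.eval x) ^ 2 ≤ S.eval x := by
    have : 0 ≤ 1 / l * (x * (1 - x) * (p.derivative.eval x) ^ 2) := by
      have := sub_nonneg.2 hx.2
      have := hx.1
      positivity
    simpa [hS] using this
  refine abs_le_of_sq_le_sq (hle.trans ?_) hB
  -- If the linear factor is nonnegative at `x`, then `S` increases on `[x, 1]`; otherwise it
  -- decreases on `[0, x]`.
  rcases le_total (2 * b + 1) (2 * c * x) with hcase | hcase
  · refine le_trans ?_ hS1
    refine monotoneOn_of_deriv_nonneg (convex_Icc x 1) S.continuous.continuousOn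
      S.differentiable.differentiableOn (fun y hy => ?_) ⟨le_rfl, hx.2⟩ ⟨hx.2, le_rfl⟩ hx.2
    rw [interior_Icc] at hy
    rw [Polynomial.deriv, hS']
    have : 2 * c * x ≤ 2 * c * y := mul_le_mul_of_nonneg_left hy.1.le (by positivity)
    exact mul_nonneg (by positivity) (by linarith)
  · refine le_trans ?_ hS0
    refine antitoneOn_of_deriv_nonpos (convex_Icc 0 x) S.continuous.continuousOn
      S.differentiable.differentiableOn (fun y hy => ?_) ⟨le_rfl, hx.1⟩ ⟨hx.1, le_rfl⟩ hx.1
    rw [interior_Icc] at hy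
    rw [Polynomial.deriv, hS']
    have : 2 * c * y ≤ 2 * c * x := mul_le_mul_of_nonneg_left hy.2.le (by positivity)
    exact mul_nonpos_of_nonneg_of_nonpos (by positivity) (by linarith)

theorem zonalFactor_nonneg {α β : ℝ} (hβ : -(1 / 2) ≤ β) (hαβ : β ≤ α) (N : ℕ) :
    0 ≤ zonalFactor α β N := by
  have h1 := (poch_pos (a := α + β + 2) (by linarith) N).le
  have h2 := (poch_pos (a := β + 1) (by linarith) (N + 1)).le
  have hN : (0 : ℝ) ≤ N := by positivity
  exact div_nonneg (mul_nonneg h1 (by linarith)) h2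

theorem jacobiZ_succ_one {α β : ℝ} (hβ : -(1 / 2) ≤ β) (hαβ : β ≤ α) (N : ℕ) :
    jacobiZ α β (N + 1) 1 =
      zonalFactor α β N * (poch (α + 1) (N + 1) / (N + 1).factorial) := by
  rw [jacobiZ, mul_div_right_comm, jacobiP_one_div_jacobiH hβ hαβ, jacobiP_one]

/-- Sonin's bound leaves only the endpoints. At `t = -1` the ratio `|Z_n(-1)| / Z_n(1)` is `(β+1)_n
/ (α+1)_n`, which is at most one because `β ≤ α`. -/
theorem abs_jacobiZ_le {α β : ℝ} (hβ : -(1 / 2) ≤ β) (hαβ : β ≤ α) (n : ℕ) {t : ℝ}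
    (ht : t ∈ Icc (-1 : ℝ) 1) : |jacobiZ α β n t| ≤ jacobiZ α β n 1 := by
  cases n with
  | zero => simp [jacobiZ_zero]
  | succ N =>
  have hM := zonalFactor_nonneg hβ hαβ N
  have hA : 0 ≤ poch (α + 1) (N + 1) / (N + 1).factorial :=
    div_nonneg (poch_pos (by linarith) _).le (by positivity)
  have hN : (0 : ℝ) ≤ N := by positivity
  have hq : ∀ t, jacobiZ α β (N + 1) t =
      (Polynomial.C (zonalFactor α β N) * jacobiPoly' α β (N + 1)).eval ((1 + t) / 2) := fun t => by
    rw [jacobiZ, mul_div_right_comm, jacobiP_one_div_jacobiH hβ hαβ, Polynomial.eval_mul,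
      Polynomial.eval_C, eval_jacobiPoly']
  have hop : hypergeomOp (-1) (α + β + 1 + 1) (-(β + 1))
      (((N + 1 : ℕ) : ℝ) * ((N + 1 : ℕ) + (α + β + 1)))
      (Polynomial.C (zonalFactor α β N) * jacobiPoly' α β (N + 1)) = 0 := by
    ext k
    have h := coeff_jacobiPoly'_rec α β (N + 1) k
    rw [coeff_hypergeomOp, Polynomial.coeff_C_mul, Polynomial.coeff_C_mul, Polynomial.coeff_zero]
    linear_combination zonalFactor α β N * h
  rw [hq t]
  refine sonin_bound ?_ (by linarith) hop ?_ ?_ ⟨by linarith [ht.1], by linarith [ht.2]⟩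
  · push_cast
    exact mul_pos (by positivity) (by linarith)
  · rw [← Polynomial.coeff_zero_eq_eval_zero, Polynomial.coeff_C_mul,
      zonalFactor_mul_coeff hβ hαβ (Nat.zero_le _), jacobiZ_succ_one hβ hαβ, zonalCoeff, zonalFactor]
    have h1 := poch_pos (a := α + β + 2) (by linarith) N
    have h2 := poch_pos (a := β + 1) (by linarith) (N + 1)
    have h3 := poch_mono (a := β + 1) (b := α + 1) (by linarith) (by linarith) (N + 1)
    have h4 : 0 < ((N + 1).factorial : ℝ) := by positivity
    have h5 : 0 < α + β + 1 + 2 * ((N : ℝ) + 1) := by linarith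
    simp only [Nat.sub_zero, add_zero, poch_zero, Nat.factorial_zero, Nat.cast_one, one_mul, abs_mul,
      abs_div, abs_pow, abs_neg, abs_one, one_pow, abs_of_pos h1, abs_of_pos h4, abs_of_pos h5]
    rw [div_mul_div_comm, div_le_div_iff₀ h4 (by positivity)]
    have := mul_le_mul_of_nonneg_left h3
      (a := (α + β + 1 + 2 * ((N : ℝ) + 1)) * poch (α + β + 2) N * (N + 1).factorial) (by positivity)
    linarith
  · have := hq 1
    rw [show (1 + (1 : ℝ)) / 2 = 1 by norm_num] at this
    rw [← this, jacobiZ_succ_one hβ hαβ, abs_of_nonneg (mul_nonneg hM hA)]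

theorem tendsto_shift_div (a b c : ℝ) (hc : c ≠ 0) :
    Tendsto (fun k : ℕ => (a + c * k) / (b + c * k)) atTop (𝓝 1) := by
  simpa [hc] using tendsto_add_mul_div_add_mul_atTop_nhds a b c hc

theorem summable_jacobiZ_one {α β : ℝ} (hβ : -(1 / 2) ≤ β) (hαβ : β ≤ α) {r : ℝ}
    (hr : r ∈ Ico (0 : ℝ) 1) : Summable fun n => jacobiZ α β n 1 * r ^ n := by
  -- The ratio test needs nonzero terms, so `r = 0` is separate.
  rcases hr.1.eq_or_lt with rfl | hr0
  · exact summable_of_ne_finset_zero (s := {0}) fun n hn => by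
      rw [zero_pow (by simpa using hn), mul_zero]
  rw [← summable_nat_add_iff 1]
  have hpos : ∀ N, 0 < jacobiZ α β (N + 1) 1 := fun N => by
    have h1 := poch_pos (a := α + β + 2) (by linarith) N
    have h2 := poch_pos (a := β + 1) (by linarith) (N + 1)
    have h3 := poch_pos (a := α + 1) (by linarith) (N + 1)
    have hN : (0 : ℝ) ≤ N := by positivity
    have h5 : 0 < α + β + 1 + 2 * ((N : ℝ) + 1) := by linarith
    rw [jacobiZ_succ_one hβ hαβ, zonalFactor]
    positivity
  refine summable_of_ratio_test_tendsto_lt_one hr.2 (Eventually.of_forall fun N =>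
    mul_ne_zero (hpos N).ne' (pow_pos hr0 _).ne') ?_
  -- The ratio of consecutive `Z_n(1)` is a product of three quotients, each tending to one.
  have hlim := (((tendsto_shift_div (α + β + 2) 2 1 one_ne_zero).mul
    (tendsto_shift_div (α + β + 5) (α + β + 3) 2 two_ne_zero)).mul
    (tendsto_shift_div (α + 2) (β + 2) 1 one_ne_zero)).mul_const r
  rw [one_mul, one_mul, one_mul] at hlim
  refine hlim.congr fun N => ?_
  rw [Real.norm_of_nonneg (mul_nonneg (hpos _).le (by positivity)),
    Real.norm_of_nonneg (mul_nonneg (hpos _).le (by positivity)),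
    jacobiZ_succ_one hβ hαβ, jacobiZ_succ_one hβ hαβ, zonalFactor, zonalFactor,
    poch_succ (α + β + 2) N, poch_succ (β + 1) (N + 1), poch_succ (α + 1) (N + 1),
    Nat.factorial_succ (N + 1)]
  have h1 := poch_pos (a := α + β + 2) (by linarith) N
  have h2 := poch_pos (a := β + 1) (by linarith) (N + 1)
  have h3 := poch_pos (a := α + 1) (by linarith) (N + 1)
  have hN : (0 : ℝ) ≤ N := by positivity
  have h4 : 0 < ((N + 1).factorial : ℝ) := by positivity
  have h5 : 0 < α + β + 1 + 2 * ((N : ℝ) + 1) := by linarith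
  have h6 : 0 < α + β + 3 + 2 * (N : ℝ) := by linarith
  have h7 : 0 < β + 2 + 1 * (N : ℝ) := by linarith
  have h8 : 0 < β + 1 + ((N : ℝ) + 1) := by linarith
  have e1 : α + β + 1 + 2 * ((N : ℝ) + 1) = α + β + 3 + 2 * N := by ring
  have e2 : β + 1 + ((N : ℝ) + 1) = β + 2 + 1 * N := by ring
  push_cast
  rw [e1, e2]
  generalize hu : α + β + 3 + 2 * (N : ℝ) = u at *
  generalize hv : β + 2 + 1 * (N : ℝ) = v at *
  field_simp
  ring

/-! ### The generating function -/

theorem ascPochhammer_eval_eq_poch (a : ℝ) (n : ℕ) : (ascPochhammer ℝ n).eval a = poch a n := by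
  induction n with
  | zero => simp [poch_zero]
  | succ n ih => rw [ascPochhammer_succ_eval, ih, poch_succ]

theorem hasSum_poch (a : ℝ) {r : ℝ} (hr : |r| < 1) :
    HasSum (fun j : ℕ => poch a j / j.factorial * r ^ j) (1 / (1 - r) ^ a) := by
  have h := (Real.one_div_one_sub_rpow_hasFPowerSeriesOnBall_zero a).hasSum (y := r)
    (by simpa [enorm_eq_nnnorm] using! hr)
  rw [zero_add] at h
  refine h.congr_fun fun j => ?_
  rw [FormalMultilinearSeries.ofScalars_apply_eq, smul_eq_mul, ← Ring.multichoose_eq,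
    ← ascPochhammer_eval_eq_poch, ← Polynomial.ascPochhammer_smeval_eq_eval,
    ← Ring.factorial_nsmul_multichoose_eq_ascPochhammer,
    nsmul_eq_mul, mul_div_cancel_left₀]
  positivity

/-- The coefficients of the series `∑ (α+β+2)_{2k} / ((β+1)_k k!) z^k`. -/
def genCoeff (α β : ℝ) (k : ℕ) : ℝ :=
  poch (α + β + 2) (2 * k) / (poch (β + 1) k * k.factorial)

theorem genCoeff_pos {α β : ℝ} (hβ : -(1 / 2) ≤ β) (hαβ : β ≤ α) (k : ℕ) : 0 < genCoeff α β k := by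
  have h1 := poch_pos (a := α + β + 2) (by linarith) (2 * k)
  have h2 := poch_pos (a := β + 1) (by linarith) k
  rw [genCoeff]; positivity

/-- The ratio of consecutive coefficients is `(s+2k)(s+2k+1) / ((β+1+k)(k+1))` with `s = α + β + 2`,
which tends to `4`. -/
theorem summable_genCoeff {α β : ℝ} (hβ : -(1 / 2) ≤ β) (hαβ : β ≤ α) {z : ℝ}
    (hz : z ∈ Ico (0 : ℝ) (1 / 4)) : Summable fun k => genCoeff α β k * z ^ k := by
  rcases hz.1.eq_or_lt with rfl | hz0
  · exact summable_of_ne_finset_zero (s := {0}) fun n hn => by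
      rw [zero_pow (by simpa using hn), mul_zero]
  have hpos := genCoeff_pos hβ hαβ
  refine summable_of_ratio_test_tendsto_lt_one (l := 4 * z) (by linarith [hz.2])
    (Eventually.of_forall fun N => mul_ne_zero (hpos N).ne' (pow_pos hz0 _).ne') ?_
  have hlim := ((tendsto_shift_div (α + β + 2) (2 * β + 2) 2 two_ne_zero).mul
    (tendsto_shift_div (α + β + 3) 2 2 two_ne_zero)).mul_const (4 * z)
  rw [one_mul, one_mul] at hlim
  refine hlim.congr fun k => ?_
  rw [Real.norm_of_nonneg (mul_nonneg (hpos _).le (by positivity)),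
    Real.norm_of_nonneg (mul_nonneg (hpos _).le (by positivity)), genCoeff, genCoeff,
    show 2 * (k + 1) = 2 * k + 1 + 1 by ring, poch_succ _ (2 * k + 1), poch_succ _ (2 * k),
    poch_succ _ k, Nat.factorial_succ]
  have h1 := poch_pos (a := α + β + 2) (by linarith) (2 * k)
  have h2 := poch_pos (a := β + 1) (by linarith) k
  have hk : (0 : ℝ) ≤ k := by positivity
  have h3 : 0 < β + 1 + (k : ℝ) := by linarith
  have e1 : 2 * β + 2 + 2 * (k : ℝ) = 2 * (β + 1 + k) := by ring
  push_cast
  rw [e1]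
  generalize hu : β + 1 + (k : ℝ) = u at *
  field_simp
  ring

/-- The double series expansion of `∑ A_k (x r)^k (1 + r)^{-(α+β+2+2k)}`. -/
def genTerm (α β x : ℝ) (p : ℕ × ℕ) : ℝ :=
  genCoeff α β p.1 * x ^ p.1 * ((-1) ^ p.2 * (poch (α + β + 2 + 2 * p.1) p.2 / p.2.factorial))

/-- Multiplication by `1 - r` takes differences in the power of `r`. The alternating sign turns this
difference into a sum, which produces the factor `α + β + 1 + 2(N+1)` of `zonalCoeff` with `N = k +
j`. -/
theorem genTerm_succ_sub {α β : ℝ} (hβ : -(1 / 2) ≤ β) (k j : ℕ) (x : ℝ) :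
    genTerm α β x (k, j + 1) - genTerm α β x (k, j) = zonalCoeff α β (k + j) k * x ^ k := by
  have h2 := (poch_pos (a := β + 1) (by linarith) k).ne'
  have h1 : k + j + 1 - k = j + 1 := by omega
  have h3 : poch (α + β + 2) (k + j + k) =
      poch (α + β + 2) (2 * k) * poch (α + β + 2 + 2 * k) j := by
    rw [show k + j + k = 2 * k + j by ring, poch_add]; push_cast; rfl
  rw [genTerm, genTerm, zonalCoeff, h1, h3]
  simp only [poch_succ, genCoeff, Nat.factorial_succ]
  push_cast
  field_simp
  ring

theorem genTerm_zero (α β : ℝ) (N : ℕ) (x : ℝ) :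
    genTerm α β x (N + 1, 0) =
      zonalCoeff α β N (N + 1) * x ^ (N + 1) := by
  rw [genTerm, genCoeff, zonalCoeff, show 2 * (N + 1) = N + (N + 1) + 1 by ring, poch_succ]
  simp only [pow_zero, poch_zero, Nat.factorial_zero, Nat.cast_one, div_one, mul_one, Nat.sub_self]
  push_cast
  ring

/-- The generating identity at the level of coefficients: the terms with `j ≥ 1` pair off with the
previous antidiagonal, and `(N + 1, 0)` is left over as the top term. -/
theorem jacobiZ_succ_eq_genTerm {α β : ℝ} (hβ : -(1 / 2) ≤ β) (hαβ : β ≤ α) (N : ℕ) (t : ℝ) :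
    jacobiZ α β (N + 1) t =
      ∑ p ∈ Finset.HasAntidiagonal.antidiagonal (N + 1), genTerm α β ((1 + t) / 2) p -
        ∑ p ∈ Finset.HasAntidiagonal.antidiagonal N, genTerm α β ((1 + t) / 2) p := by
  rw [jacobiZ_succ_eq_sum hβ hαβ, Finset.sum_range_succ,
    Finset.Nat.antidiagonal_succ', Finset.sum_cons, Finset.sum_map, add_comm, add_sub_assoc,
    ← Finset.sum_sub_distrib, Finset.Nat.sum_antidiagonal_eq_sum_range_succ_mk]
  congr 1
  · exact (genTerm_zero α β N _).symm
  · refine Finset.sum_congr rfl fun k hk => ?_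
    obtain ⟨j, rfl⟩ : ∃ j, N = k + j := ⟨N - k, by simp at hk; omega⟩
    have := genTerm_succ_sub (α := α) hβ k j ((1 + t) / 2)
    simpa using this.symm

open Finset.HasAntidiagonal in
theorem hasSum_antidiagonal {f : ℕ × ℕ → ℝ} {a : ℝ} (h : HasSum f a) :
    HasSum (fun n => ∑ p ∈ antidiagonal n, f p) a := by
  have h' := (Finset.HasAntidiagonal.sigmaAntidiagonalEquivProd (A := ℕ)).hasSum_iff.2 h
  refine (h'.sigma fun n => hasSum_fintype _).congr_fun fun n => ?_
  rw [← Finset.sum_coe_sort (antidiagonal n) f]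
  rfl

theorem analyticOnNhd_tsum_mul_pow {a : ℕ → ℝ} {R : ℝ}
    (h : ∀ r ∈ Ico (0 : ℝ) R, Summable fun n => |a n| * r ^ n) :
    AnalyticOnNhd ℝ (fun r => ∑' n, a n * r ^ n) (Metric.ball 0 R) := by
  set p := FormalMultilinearSeries.ofScalars ℝ a with hp
  have hrad : ENNReal.ofReal R ≤ p.radius := by
    refine ENNReal.le_of_forall_nnreal_lt fun r hr => ?_
    refine p.le_radius_of_summable_norm ?_
    have := h r ⟨r.2, by simpa [ENNReal.lt_ofReal_iff_toReal_lt] using hr⟩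
    simpa [hp, FormalMultilinearSeries.ofScalars_norm] using this
  intro y hy
  have hyR : |y| < R := by simpa using hy
  have hR : 0 < R := (abs_nonneg y).trans_lt hyR
  have hps := p.hasFPowerSeriesOnBall ((ENNReal.ofReal_pos.2 hR).trans_le hrad)
  have hfun : p.sum = fun r => ∑' n, a n * r ^ n := by
    ext r
    refine tsum_congr fun n => ?_
    rw [hp, FormalMultilinearSeries.ofScalars_apply_eq, smul_eq_mul]
  rw [← hfun]
  refine hps.analyticAt_of_mem ?_
  refine Metric.eball_subset_eball hrad ?_
  rw [Metric.eball_ofReal]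
  exact hy

section

variable {α β : ℝ} {x : ℝ}

/-- The sum `∑ A_k z^k` of the hypergeometric series. -/
def genSum (α β z : ℝ) : ℝ := ∑' k, genCoeff α β k * z ^ k

theorem genSum_nonneg (hβ : -(1 / 2) ≤ β) (hαβ : β ≤ α) {z : ℝ} (hz : 0 ≤ z) :
    0 ≤ genSum α β z :=
  tsum_nonneg fun k => mul_nonneg (genCoeff_pos hβ hαβ k).le (pow_nonneg hz k)

theorem rpow_add_two_mul {y : ℝ} (hy : 0 < y) (s : ℝ) (k : ℕ) :
    1 / y ^ (s + 2 * k) = y ^ (-s) * (1 / y ^ 2) ^ k := by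
  rw [Real.rpow_add hy, Real.rpow_neg hy.le, show (2 : ℝ) * k = ((2 * k : ℕ) : ℝ) by push_cast; rfl,
    Real.rpow_natCast, pow_mul, div_pow, one_pow]
  field_simp

/-- The inner sums of the double series. -/
theorem hasSum_genTerm_inner (α β x : ℝ) (k : ℕ) {r : ℝ} (hr : |r| < 1) :
    HasSum (fun j => genTerm α β x (k, j) * r ^ (k + j))
      ((1 + r) ^ (-(α + β + 2)) * (genCoeff α β k * (x * r / (1 + r) ^ 2) ^ k)) := by
  have h := (hasSum_poch (α + β + 2 + 2 * k) (r := -r) (by simpa using hr)).mul_left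
    (genCoeff α β k * x ^ k * r ^ k)
  rw [sub_neg_eq_add, rpow_add_two_mul (by linarith [(abs_lt.1 hr).1])] at h
  convert! h using 1
  · ext j
    rw [genTerm, neg_pow r j]; ring
  · rw [mul_div_assoc, mul_pow, div_pow, div_pow]; ring

/-- Taking absolute values removes the alternating sign, so `1 - |r|` replaces `1 + r`. -/
theorem hasSum_abs_genTerm_inner (hβ : -(1 / 2) ≤ β) (hαβ : β ≤ α) (hx : 0 ≤ x) (k : ℕ) {r : ℝ}
    (hr : |r| < 1) :
    HasSum (fun j => ‖genTerm α β x (k, j) * r ^ (k + j)‖)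
      ((1 - |r|) ^ (-(α + β + 2)) * (genCoeff α β k * (x * |r| / (1 - |r|) ^ 2) ^ k)) := by
  have h := (hasSum_poch (α + β + 2 + 2 * k) (r := |r|) (by simpa using hr)).mul_left
    (genCoeff α β k * x ^ k * |r| ^ k)
  rw [rpow_add_two_mul (by linarith)] at h
  convert! h using 1
  · ext j
    have h1 : 0 ≤ poch (α + β + 2 + 2 * k) j := by
      have : (0 : ℝ) ≤ k := by positivity
      exact (poch_pos (by linarith) j).le
    have h2 := genCoeff_pos hβ hαβ k
    rw [genTerm]
    simp only [norm_mul, norm_pow, norm_neg, norm_one, one_pow, norm_div, Real.norm_eq_abs,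
      abs_of_pos h2, abs_of_nonneg hx, abs_of_nonneg h1, Nat.abs_cast]
    ring
  · rw [mul_div_assoc, mul_pow, div_pow, div_pow]; ring

/-- Absolute convergence of the double series needs `|r| / (1 - |r|)²` inside the disc of radius
`1/4`; `1/10` is a convenient sufficient bound. -/
theorem four_mul_lt_sq {r : ℝ} (hr : |r| < 1 / 10) : |r| / (1 - |r|) ^ 2 < 1 / 4 := by
  have := abs_nonneg r
  rw [div_lt_iff₀ (by nlinarith)]
  nlinarith

theorem summable_genTerm (hβ : -(1 / 2) ≤ β) (hαβ : β ≤ α) (hx : x ∈ Icc (0 : ℝ) 1) {r : ℝ}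
    (hr : |r| < 1 / 10) :
    Summable fun p : ℕ × ℕ => genTerm α β x p * r ^ (p.1 + p.2) := by
  have hr1 : |r| < 1 := by linarith
  have h0 := abs_nonneg r
  refine Summable.of_norm ((summable_prod_of_nonneg fun p => norm_nonneg _).2
    ⟨fun k => (hasSum_abs_genTerm_inner hβ hαβ hx.1 k hr1).summable, ?_⟩)
  simp only [fun k => (hasSum_abs_genTerm_inner hβ hαβ hx.1 k hr1).tsum_eq]
  refine (summable_genCoeff hβ hαβ ⟨?_, ?_⟩).mul_left _
  · exact div_nonneg (mul_nonneg hx.1 h0) (sq_nonneg _)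
  · refine lt_of_le_of_lt ?_ (four_mul_lt_sq hr)
    gcongr
    exact mul_le_of_le_one_left h0 hx.2

open Finset.HasAntidiagonal in
theorem hasSum_antidiagonal_genTerm (hβ : -(1 / 2) ≤ β) (hαβ : β ≤ α) (hx : x ∈ Icc (0 : ℝ) 1)
    {r : ℝ} (hr : |r| < 1 / 10) :
    HasSum (fun n => (∑ p ∈ antidiagonal n, genTerm α β x p) * r ^ n)
      ((1 + r) ^ (-(α + β + 2)) * genSum α β (x * r / (1 + r) ^ 2)) := by
  have hs := summable_genTerm hβ hαβ hx hr
  have h := hasSum_antidiagonal hs.hasSum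
  have htot : ∑' p : ℕ × ℕ, genTerm α β x p * r ^ (p.1 + p.2) =
      (1 + r) ^ (-(α + β + 2)) * genSum α β (x * r / (1 + r) ^ 2) := by
    rw [hs.tsum_prod, genSum, ← tsum_mul_left]
    exact tsum_congr fun k => (hasSum_genTerm_inner α β x k (by linarith)).tsum_eq
  rw [htot] at h
  refine h.congr_fun fun n => ?_
  rw [Finset.sum_mul]
  exact Finset.sum_congr rfl fun p hp => by rw [mem_antidiagonal.1 hp]

theorem hasSum_jacobiZ_of_small (hβ : -(1 / 2) ≤ β) (hαβ : β ≤ α) {t : ℝ}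
    (ht : t ∈ Icc (-1 : ℝ) 1) {r : ℝ} (hr : |r| < 1 / 10) :
    HasSum (fun n => jacobiZ α β n t * r ^ n)
      ((1 - r) * ((1 + r) ^ (-(α + β + 2)) * genSum α β ((1 + t) / 2 * r / (1 + r) ^ 2))) := by
  have h := hasSum_antidiagonal_genTerm hβ hαβ (x := (1 + t) / 2)
    ⟨by linarith [ht.1], by linarith [ht.2]⟩ hr
  rw [← hasSum_nat_add_iff' 1]
  have h1 := ((hasSum_nat_add_iff' 1).2 h).sub (h.mul_left r)
  convert! h1 using 1
  · ext N
    rw [jacobiZ_succ_eq_genTerm hβ hαβ, pow_succ]; ring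
  · have hA : genTerm α β ((1 + t) / 2) (0, 0) = 1 := by simp [genTerm, genCoeff, poch_zero]
    simp [jacobiZ_zero, hA]
    ring

/-- Rearrangement is available only for `|r| < 1/10`. Both sides are analytic in `r` on `(-1/10,
1)`, so the identity theorem carries the equality to all of `[0, 1)`. -/
theorem tsum_jacobiZ (hβ : -(1 / 2) ≤ β) (hαβ : β ≤ α) {t : ℝ}
    (ht : t ∈ Icc (-1 : ℝ) 1) {r : ℝ} (hr : r ∈ Ico (0 : ℝ) 1) :
    ∑' n, jacobiZ α β n t * r ^ n =
      (1 - r) * ((1 + r) ^ (-(α + β + 2)) * genSum α β ((1 + t) / 2 * r / (1 + r) ^ 2)) := by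
  have hx0 : 0 ≤ (1 + t) / 2 := by linarith [ht.1]
  have hx1 : (1 + t) / 2 ≤ 1 := by linarith [ht.2]
  have hZ : AnalyticOnNhd ℝ (fun r => ∑' n, jacobiZ α β n t * r ^ n) (Ioo (-(1 / 10)) 1) := by
    refine (analyticOnNhd_tsum_mul_pow (R := 1) fun r hr => ?_).mono fun r hr => ?_
    · exact Summable.of_nonneg_of_le (fun n => mul_nonneg (abs_nonneg _) (pow_nonneg hr.1 n))
        (fun n => mul_le_mul_of_nonneg_right (abs_jacobiZ_le hβ hαβ n ht) (pow_nonneg hr.1 n))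
        (summable_jacobiZ_one hβ hαβ hr)
    · rw [mem_ball_zero_iff, Real.norm_eq_abs, abs_lt]
      exact ⟨by linarith [hr.1], hr.2⟩
  have hH : AnalyticOnNhd ℝ (genSum α β) (Metric.ball 0 (1 / 4)) :=
    analyticOnNhd_tsum_mul_pow fun r hr => (summable_genCoeff hβ hαβ hr).congr fun k => by
      rw [abs_of_pos (genCoeff_pos hβ hαβ k)]
  have hF : AnalyticOnNhd ℝ (fun r => (1 - r) * ((1 + r) ^ (-(α + β + 2)) *
      genSum α β ((1 + t) / 2 * r / (1 + r) ^ 2))) (Ioo (-(1 / 10)) 1) := by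
    intro r hr
    have hr1 : 0 < 1 + r := by linarith [hr.1]
    have hadd : AnalyticAt ℝ (fun r : ℝ => 1 + r) r := analyticAt_const.add analyticAt_id
    have hpow : AnalyticAt ℝ (fun r : ℝ => (1 + r) ^ (-(α + β + 2))) r := by
      have h1 : AnalyticAt ℝ (fun r : ℝ => Real.exp (Real.log (1 + r) * (-(α + β + 2)))) r :=
        ((hadd.log hr1).mul analyticAt_const).rexp
      refine h1.congr ?_
      filter_upwards [Ioi_mem_nhds (show -1 < r by linarith)] with y hy
      rw [Real.rpow_def_of_pos (by linarith [mem_Ioi.1 hy])]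
    have hq : AnalyticAt ℝ (fun r : ℝ => (1 + t) / 2 * r / (1 + r) ^ 2) r :=
      (analyticAt_const.mul analyticAt_id).div (hadd.pow 2) (by positivity)
    refine (analyticAt_const.sub analyticAt_id).mul (hpow.mul ?_)
    refine AnalyticAt.fun_comp (hH _ ?_) hq
    rw [mem_ball_zero_iff, Real.norm_eq_abs, abs_div, abs_mul, abs_of_nonneg hx0,
      abs_of_pos (by positivity : 0 < (1 + r) ^ 2), div_lt_iff₀ (by positivity)]
    have h2 : (1 + t) / 2 * |r| ≤ |r| := mul_le_of_le_one_left (abs_nonneg r) hx1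
    refine h2.trans_lt ?_
    -- For `r ≥ 0` the claim `4r < (1 + r)²` is `(1 - r)² > 0`; for negative `r` the bound `r >
    -- -1/10` suffices.
    rcases abs_cases r with ⟨h, h'⟩ | ⟨h, h'⟩
    · rw [h]; nlinarith [mul_pos (sub_pos.2 hr.2) (sub_pos.2 hr.2)]
    · rw [h]; nlinarith [hr.1]
  refine hZ.eqOn_of_preconnected_of_eventuallyEq hF isPreconnected_Ioo (z₀ := 0)
    ⟨by norm_num, by norm_num⟩ ?_ ⟨by linarith [hr.1], hr.2⟩
  filter_upwards [Metric.ball_mem_nhds (0 : ℝ) (show (0 : ℝ) < 1 / 10 by norm_num)] with y hy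
  exact (hasSum_jacobiZ_of_small hβ hαβ ht (by simpa using hy)).tsum_eq

theorem tsum_jacobiZ_nonneg (hβ : -(1 / 2) ≤ β) (hαβ : β ≤ α) {t : ℝ}
    (ht : t ∈ Icc (-1 : ℝ) 1) {r : ℝ} (hr : r ∈ Ico (0 : ℝ) 1) :
    0 ≤ ∑' n, jacobiZ α β n t * r ^ n := by
  have h1 := hr.1
  have h2 : 0 ≤ 1 - r := by linarith [hr.2]
  have h3 : 0 ≤ (1 + t) / 2 := by linarith [ht.1]
  rw [tsum_jacobiZ hβ hαβ ht hr]
  exact mul_nonneg h2 (mul_nonneg (by positivity) (genSum_nonneg hβ hαβ (by positivity)))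

end

/-! ### Polynomials restricted to `Ω` -/

section

variable {d : ℕ} {Ω : Set (EuclideanSpace ℝ (Fin d))}

theorem polySpace_mono {m n : ℕ} (h : m ≤ n) : polySpace Ω m ≤ polySpace Ω n :=
  Submodule.map_mono fun p hp => by
    rw [MvPolynomial.mem_restrictTotalDegree] at hp ⊢
    exact hp.trans h

theorem one_mem_polySpace : (1 : C(Ω, ℝ)) ∈ polySpace Ω 0 :=
  ⟨1, by simp [MvPolynomial.mem_restrictTotalDegree], by ext x; simp [restrictPoly]⟩

theorem integrable_mul_cont [CompactSpace Ω] (μ : Measure Ω) {f : Ω → ℝ} (hf : Integrable f μ) (g : C(Ω, ℝ)) :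
    Integrable (fun x => f x * g x) μ :=
  hf.mul_bdd (c := ‖g‖) g.continuous.aestronglyMeasurable
    (Eventually.of_forall fun x => g.norm_coe_le_norm x)

end

section

variable {d : ℕ} {Ω : Set (EuclideanSpace ℝ (Fin d))} [CompactSpace Ω]
  (μ : Measure Ω) [IsFiniteMeasure μ]

/-! ### Orthogonal expansions of polynomials -/

theorem innerForm_apply (f g : C(Ω, ℝ)) : innerForm μ f g = ∫ x, f x * g x ∂μ := rfl

theorem innerForm_comm (f g : C(Ω, ℝ)) : innerForm μ f g = innerForm μ g f := by
  simp [innerForm_apply, mul_comm]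

theorem innerForm_orthoSpace_of_ne {m n : ℕ} (h : m ≠ n) {p q : C(Ω, ℝ)} (hp : p ∈ orthoSpace μ m)
    (hq : q ∈ orthoSpace μ n) : innerForm μ p q = 0 := by
  rcases lt_or_gt_of_ne h with h | h
  · rw [innerForm_comm]; exact hq.2 m h p hp.1
  · exact hp.2 n h q hq.1

/-- The orthogonal projection onto `𝒱_n` as a linear map on continuous functions. -/
def projC (n : ℕ) : C(Ω, ℝ) →ₗ[ℝ] C(Ω, ℝ) :=
  ∑ k, (((innerForm μ).flip (orthoBasis μ n k : C(Ω, ℝ))).smulRight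
    ((innerForm μ (orthoBasis μ n k) (orthoBasis μ n k))⁻¹ • (orthoBasis μ n k : C(Ω, ℝ))))

theorem projC_apply (n : ℕ) (f : C(Ω, ℝ)) :
    projC μ n f = ∑ k, innerForm μ f (orthoBasis μ n k) •
      ((innerForm μ (orthoBasis μ n k) (orthoBasis μ n k))⁻¹ • (orthoBasis μ n k : C(Ω, ℝ))) := by
  simp [projC, LinearMap.sum_apply]

theorem projC_mem (n : ℕ) (f : C(Ω, ℝ)) : projC μ n f ∈ orthoSpace μ n := by
  rw [projC_apply]
  exact Submodule.sum_mem _ fun k _ => Submodule.smul_mem _ _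
    (Submodule.smul_mem _ _ (orthoBasis μ n k).2)

theorem reproKernel_comm (n : ℕ) (x y : Ω) : reproKernel μ n x y = reproKernel μ n y x :=
  Finset.sum_congr rfl fun k _ => by rw [mul_comm]

theorem continuous_reproKernel (n : ℕ) : Continuous fun p : Ω × Ω => reproKernel μ n p.1 p.2 := by
  unfold reproKernel
  refine continuous_finsetSum _ fun k _ => Continuous.div_const (Continuous.mul ?_ ?_) _
  · exact (orthoBasis μ n k : C(Ω, ℝ)).continuous.comp continuous_fst
  · exact (orthoBasis μ n k : C(Ω, ℝ)).continuous.comp continuous_snd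

theorem projOp_eq_sum (n : ℕ) {f : Ω → ℝ} (hf : Integrable f μ) (x : Ω) :
    projOp μ n f x = ∑ k, (orthoBasis μ n k : C(Ω, ℝ)) x *
      ((∫ y, f y * (orthoBasis μ n k : C(Ω, ℝ)) y ∂μ) /
        innerForm μ (orthoBasis μ n k) (orthoBasis μ n k)) := by
  simp only [projOp, reproKernel, Finset.mul_sum]
  rw [integral_finsetSum]
  · refine Finset.sum_congr rfl fun k _ => ?_
    rw [← integral_div, ← integral_const_mul]
    exact integral_congr_ae (Eventually.of_forall fun y => by ring_nf)
  · intro k _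
    refine ((integrable_mul_cont μ hf (orthoBasis μ n k : C(Ω, ℝ))).const_mul
      ((orthoBasis μ n k : C(Ω, ℝ)) x /
        innerForm μ (orthoBasis μ n k) (orthoBasis μ n k))).congr
      (Eventually.of_forall fun y => by ring_nf)

theorem projC_eq_projOp (n : ℕ) (f : C(Ω, ℝ)) (x : Ω) : projC μ n f x = projOp μ n f x := by
  rw [projOp_eq_sum μ n (integrable_cont μ f), projC_apply, ContinuousMap.sum_apply]
  refine Finset.sum_congr rfl fun k _ => ?_
  rw [innerForm_apply μ f]
  simp only [ContinuousMap.smul_apply, smul_eq_mul]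
  ring

theorem continuous_projOp (n : ℕ) {f : Ω → ℝ} (hf : Integrable f μ) :
    Continuous (projOp μ n f) := by
  rw [show projOp μ n f = _ from funext fun x => projOp_eq_sum μ n hf x]
  exact continuous_finsetSum _ fun k _ =>
    (orthoBasis μ n k : C(Ω, ℝ)).continuous.mul continuous_const

theorem innerForm_projC_left (n : ℕ) (f g : C(Ω, ℝ)) :
    innerForm μ (projC μ n f) g = innerForm μ f (projC μ n g) := by
  simp only [projC_apply, map_sum, LinearMap.sum_apply, map_smul, LinearMap.smul_apply, smul_eq_mul]
  refine Finset.sum_congr rfl fun k _ => ?_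
  rw [innerForm_comm μ _ g]
  ring

theorem orthoBasis_orthogonal (n : ℕ) (j k) (h : j ≠ k) :
    innerForm μ (orthoBasis μ n j) (orthoBasis μ n k) = 0 :=
  (exists_ortho_basis μ n).choose_spec j k h

theorem projC_of_mem_of_ne {m n : ℕ} (h : m ≠ n) {p : C(Ω, ℝ)} (hp : p ∈ orthoSpace μ m) :
    projC μ n p = 0 := by
  rw [projC_apply]
  exact Finset.sum_eq_zero fun k _ => by
    rw [innerForm_orthoSpace_of_ne μ h hp (orthoBasis μ n k).2, zero_smul]

theorem projC_of_mem_polySpace_of_lt {m n : ℕ} (h : m < n) {p : C(Ω, ℝ)} (hp : p ∈ polySpace Ω m) :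
    projC μ n p = 0 := by
  rw [projC_apply]
  exact Finset.sum_eq_zero fun k _ => by
    rw [innerForm_comm, (orthoBasis μ n k).2.2 m h p hp, zero_smul]

theorem projC_orthoBasis (hinner : IsInnerOnPoly μ) (n : ℕ) (j) :
    projC μ n (orthoBasis μ n j) = orthoBasis μ n j := by
  rw [projC_apply, Finset.sum_eq_single j]
  · rw [smul_smul, mul_inv_cancel₀, one_smul]
    intro h0
    exact (orthoBasis μ n).ne_zero j (Subtype.ext (hinner n _ (orthoBasis μ n j).2.1 h0))
  · intro k _ hk
    rw [orthoBasis_orthogonal μ n j k hk.symm, zero_smul]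
  · simp

theorem projC_of_mem (hinner : IsInnerOnPoly μ) {n : ℕ} {p : C(Ω, ℝ)} (hp : p ∈ orthoSpace μ n) :
    projC μ n p = p := by
  have h : (projC μ n).comp (orthoSpace μ n).subtype = (orthoSpace μ n).subtype :=
    (orthoBasis μ n).ext fun j => projC_orthoBasis μ hinner n j
  exact LinearMap.congr_fun h ⟨p, hp⟩

/-- Subtracting from `p` its projections of index below `n` leaves an element of `𝒱_n`: by induction
each `q` of lower degree is a sum of elements of the `𝒱_i`, `i < n`, to which the remainder is
orthogonal. The projection onto `𝒱_n` fixes this remainder and kills what was subtracted. -/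
theorem sum_projC_of_mem_polySpace (hinner : IsInnerOnPoly μ) (n : ℕ) :
    ∀ p ∈ polySpace Ω n, ∑ k ∈ Finset.range (n + 1), projC μ k p = p := by
  induction n using Nat.strong_induction_on with
  | _ n ih =>
  intro p hp
  have horth : ∀ i < n, ∀ h ∈ orthoSpace μ i,
      innerForm μ (p - ∑ k ∈ Finset.range n, projC μ k p) h = 0 := by
    intro i hi h hh
    rw [map_sub, LinearMap.sub_apply, map_sum, LinearMap.sum_apply, Finset.sum_eq_single i]
    · rw [innerForm_projC_left, projC_of_mem μ hinner hh, sub_self]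
    · intro k _ hk
      exact innerForm_orthoSpace_of_ne μ hk (projC_mem μ k p) hh
    · intro h'
      exact absurd (Finset.mem_range.2 hi) h'
  have hmem : p - ∑ k ∈ Finset.range n, projC μ k p ∈ orthoSpace μ n := by
    refine ⟨Submodule.sub_mem _ hp (Submodule.sum_mem _ fun k hk =>
      polySpace_mono (Finset.mem_range.1 hk).le (projC_mem μ k p).1), fun j hj q hq => ?_⟩
    rw [← ih j hj q hq, map_sum]
    exact Finset.sum_eq_zero fun i hi => horth i
      ((Nat.lt_succ_iff.1 (Finset.mem_range.1 hi)).trans_lt hj) _ (projC_mem μ i q)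
  have h := projC_of_mem μ hinner hmem
  rw [map_sub, map_sum, Finset.sum_eq_zero fun k hk =>
    projC_of_mem_of_ne μ (Finset.mem_range.1 hk).ne (projC_mem μ k p), sub_zero] at h
  rw [Finset.sum_range_succ, h]
  abel

theorem poissonInt_of_mem_polySpace (r : ℝ) {N : ℕ} {p : C(Ω, ℝ)} (hp : p ∈ polySpace Ω N) (x : Ω) :
    poissonInt μ r p x = ∑ n ∈ Finset.range (N + 1), projC μ n p x * r ^ n := by
  simp only [poissonInt, ← projC_eq_projOp]
  refine tsum_eq_sum fun n hn => ?_
  rw [projC_of_mem_polySpace_of_lt μ (by simpa using hn) hp]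
  simp

theorem poissonInt_one (hinner : IsInnerOnPoly μ) (r : ℝ) (x : Ω) :
    poissonInt μ r (fun _ => 1) x = 1 := by
  have h := poissonInt_of_mem_polySpace μ r one_mem_polySpace x
  have h1 := sum_projC_of_mem_polySpace μ hinner 0 1 one_mem_polySpace
  simp only [zero_add, Finset.sum_range_one, pow_zero, mul_one] at h h1
  rw [h1] at h
  exact h

theorem tendstoUniformly_poissonInt_of_mem_polySpace (hinner : IsInnerOnPoly μ) {N : ℕ}
    {p : C(Ω, ℝ)} (hp : p ∈ polySpace Ω N) :
    TendstoUniformly (fun (r : ℝ) (x : Ω) => poissonInt μ r p x) p (𝓝[<] 1) := by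
  have hlim : Tendsto (fun r : ℝ => ∑ n ∈ Finset.range (N + 1), ‖projC μ n p‖ * |1 - r ^ n|)
      (𝓝[<] 1) (𝓝 0) := by
    have hc : Continuous fun r : ℝ =>
        ∑ n ∈ Finset.range (N + 1), ‖projC μ n p‖ * |1 - r ^ n| := by fun_prop
    have := (hc.tendsto 1).mono_left (nhdsWithin_le_nhds (s := Iio 1))
    simpa using this
  rw [Metric.tendstoUniformly_iff]
  intro ε hε
  filter_upwards [hlim.eventually_lt_const hε] with r hr x
  refine lt_of_le_of_lt ?_ hr
  rw [poissonInt_of_mem_polySpace μ r hp, Real.dist_eq]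
  nth_rw 1 [← sum_projC_of_mem_polySpace μ hinner N p hp]
  rw [ContinuousMap.sum_apply, ← Finset.sum_sub_distrib]
  refine (Finset.abs_sum_le_sum_abs _ _).trans (Finset.sum_le_sum fun n _ => ?_)
  rw [← mul_one_sub, abs_mul]
  exact mul_le_mul_of_nonneg_right ((projC μ n p).norm_coe_le_norm x) (abs_nonneg _)

/-- Stone–Weierstrass for the algebra generated by the coordinate functions, which separate points.
-/
theorem exists_polySpace_near (f : C(Ω, ℝ)) {ε : ℝ} (hε : 0 < ε) :
    ∃ N, ∃ p ∈ polySpace Ω N, ‖p - f‖ < ε := by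
  let c : Fin d → C(Ω, ℝ) := fun i => ⟨fun x => (x : EuclideanSpace ℝ (Fin d)) i, by fun_prop⟩
  have hsep : (MvPolynomial.aeval c : MvPolynomial (Fin d) ℝ →ₐ[ℝ] C(Ω, ℝ)).range.SeparatesPoints := by
    intro x y hxy
    obtain ⟨i, hi⟩ : ∃ i, (x : EuclideanSpace ℝ (Fin d)) i ≠ (y : EuclideanSpace ℝ (Fin d)) i := by
      by_contra! h
      exact hxy (Subtype.ext (PiLp.ext h))
    exact ⟨c i, ⟨c i, ⟨MvPolynomial.X i, by simp⟩, rfl⟩, hi⟩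
  obtain ⟨⟨_, q, rfl⟩, hq⟩ :=
    ContinuousMap.exists_mem_subalgebra_near_continuousMap_of_separatesPoints _ hsep f ε hε
  refine ⟨q.totalDegree, restrictPoly Ω q, ⟨q, ?_, rfl⟩, ?_⟩
  · exact (MvPolynomial.mem_restrictTotalDegree _ _ _).2 le_rfl
  · convert hq using 3
    clear hq
    ext x
    change MvPolynomial.eval _ q = MvPolynomial.aeval c q x
    induction q using MvPolynomial.induction_on with
    | C a => simp
    | add p q hp hq => simp [hp, hq]
    | mul_X p i hp => simp [hp, c]

end

/-! ### Integral operators with a continuous doubly stochastic kernel -/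

theorem integrable_mul_kernel {X : Type*} [TopologicalSpace X] [CompactSpace X]
    [MeasurableSpace X] [BorelSpace X] {μ : Measure X} {k : X × X → ℝ} (hk : Continuous k)
    {f : X → ℝ} (hf : Integrable f μ) (x : X) :
    Integrable (fun y => f y * k (x, y)) μ := by
  have hc : Continuous fun y => k (x, y) := by fun_prop
  obtain ⟨C, hC⟩ := isCompact_univ.exists_bound_of_continuousOn hc.continuousOn
  exact hf.mul_bdd (c := C) hc.aestronglyMeasurable (Eventually.of_forall fun y => hC y (mem_univ y))

theorem lintegral_kernel {X : Type*} [TopologicalSpace X] [CompactSpace X]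
    [MeasurableSpace X] [BorelSpace X] {μ : Measure X} [IsProbabilityMeasure μ] {k : X × X → ℝ}
    (hk : Continuous k) (hk0 : ∀ p, 0 ≤ k p)
    (hk1 : ∀ x, ∫ y, k (x, y) ∂μ = 1) (x : X) : ∫⁻ y, ENNReal.ofReal (k (x, y)) ∂μ = 1 := by
  have hi : Integrable (fun y => k (x, y)) μ := by
    simpa using integrable_mul_kernel hk (integrable_const (1 : ℝ)) x
  rw [← ofReal_integral_eq_lintegral_ofReal hi (Eventually.of_forall fun y => hk0 _), hk1,
    ENNReal.ofReal_one]

section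

variable {X : Type*} [TopologicalSpace X] [CompactSpace X]
  [MeasurableSpace X] [BorelSpace X] {μ : Measure X} [IsProbabilityMeasure μ] {k : X × X → ℝ}

/-- The integral is the mean of `f` under the probability measure `k(x, ·) dμ`, on which `L^p` norms
increase with `p`. -/
theorem enorm_integral_kernel_le (hk : Continuous k) (hk0 : ∀ p, 0 ≤ k p)
    (hk1 : ∀ x, ∫ y, k (x, y) ∂μ = 1) {p : ℝ≥0∞} (hp : 1 ≤ p) {f : X → ℝ}
    (hf : AEStronglyMeasurable f μ) (x : X) :
    ‖∫ y, f y * k (x, y) ∂μ‖ₑ ≤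
      eLpNorm f p (μ.withDensity fun y => ENNReal.ofReal (k (x, y))) := by
  have hm : Measurable fun y => ENNReal.ofReal (k (x, y)) := by
    have hc : Continuous fun y => k (x, y) := by fun_prop
    exact hc.measurable.ennreal_ofReal
  set ν := μ.withDensity fun y => ENNReal.ofReal (k (x, y)) with hν
  have hprob : IsProbabilityMeasure ν := ⟨by
    rw [hν, withDensity_apply _ MeasurableSet.univ, Measure.restrict_univ,
      lintegral_kernel hk hk0 hk1]⟩
  have hfν : AEStronglyMeasurable f ν := hf.mono_ac (withDensity_absolutelyContinuous _ _)
  have hint : ∫ y, f y * k (x, y) ∂μ = ∫ y, f y ∂ν := by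
    rw [hν, integral_withDensity_eq_integral_toReal_smul hm
      (Eventually.of_forall fun y => ENNReal.ofReal_lt_top)]
    refine integral_congr_ae (Eventually.of_forall fun y => ?_)
    simp only [ENNReal.toReal_ofReal (hk0 _), smul_eq_mul, mul_comm]
  rw [hint]
  calc ‖∫ y, f y ∂ν‖ₑ ≤ ∫⁻ y, ‖f y‖ₑ ∂ν := enorm_integral_le_lintegral_enorm _
    _ = eLpNorm f 1 ν := eLpNorm_one_eq_lintegral_enorm.symm
    _ ≤ eLpNorm f p ν := eLpNorm_le_eLpNorm_of_exponent_le hp hfν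

/-- For finite `p`, raise the pointwise bound to the power `p`, integrate in `x` and apply Tonelli;
by symmetry the kernel also has mass one in `x`. For `p = ∞`, absolute continuity of `k(x, ·) dμ`
suffices. -/
theorem eLpNorm_integral_kernel_le [SecondCountableTopology X] (hk : Continuous k) (hk0 : ∀ p, 0 ≤ k p)
    (hks : ∀ x y, k (x, y) = k (y, x))
    (hk1 : ∀ x, ∫ y, k (x, y) ∂μ = 1) {p : ℝ≥0∞} (hp : 1 ≤ p) {f : X → ℝ}
    (hf : AEStronglyMeasurable f μ) :
    eLpNorm (fun x => ∫ y, f y * k (x, y) ∂μ) p μ ≤ eLpNorm f p μ := by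
  rcases eq_or_ne p ∞ with rfl | hpt
  · rw [eLpNorm_exponent_top]
    refine eLpNormEssSup_le_of_ae_enorm_bound (Eventually.of_forall fun x => ?_)
    refine (enorm_integral_kernel_le hk hk0 hk1 hp hf x).trans ?_
    rw [eLpNorm_exponent_top, eLpNorm_exponent_top]
    exact eLpNormEssSup_mono_measure _ (withDensity_absolutelyContinuous _ _)
  have hp0 : p ≠ 0 := (zero_lt_one.trans_le hp).ne'
  have hpos : 0 < p.toReal := ENNReal.toReal_pos hp0 hpt
  have hkm : Measurable fun q : X × X => ENNReal.ofReal (k q) := hk.measurable.ennreal_ofReal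
  rw [eLpNorm_eq_lintegral_rpow_enorm_toReal hp0 hpt, eLpNorm_eq_lintegral_rpow_enorm_toReal hp0 hpt]
  refine ENNReal.rpow_le_rpow ?_ (by positivity)
  have hfm : AEMeasurable (fun y => ‖f y‖ₑ ^ p.toReal) μ := hf.enorm.pow_const _
  calc ∫⁻ x, ‖∫ y, f y * k (x, y) ∂μ‖ₑ ^ p.toReal ∂μ
      ≤ ∫⁻ x, ∫⁻ y, ENNReal.ofReal (k (x, y)) * ‖f y‖ₑ ^ p.toReal ∂μ ∂μ := by
        refine lintegral_mono fun x => ?_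
        have h := enorm_integral_kernel_le hk hk0 hk1 hp hf x
        have hm : Measurable fun y => ENNReal.ofReal (k (x, y)) :=
          hkm.comp measurable_prodMk_left
        rw [eLpNorm_eq_lintegral_rpow_enorm_toReal hp0 hpt, one_div,
          ENNReal.le_rpow_inv_iff hpos] at h
        refine h.trans_eq ?_
        rw [lintegral_withDensity_eq_lintegral_mul₀ hm.aemeasurable hfm]
        rfl
    _ = ∫⁻ y, ∫⁻ x, ENNReal.ofReal (k (x, y)) * ‖f y‖ₑ ^ p.toReal ∂μ ∂μ :=
        lintegral_lintegral_swap (hkm.aemeasurable.mul hfm.comp_snd)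
    _ = ∫⁻ y, ‖f y‖ₑ ^ p.toReal ∂μ := by
        refine lintegral_congr fun y => ?_
        rw [lintegral_mul_const _ (show Measurable fun x => ENNReal.ofReal (k (x, y)) from
          hkm.comp measurable_prodMk_right)]
        simp only [fun x => hks x y, lintegral_kernel hk hk0 hk1, one_mul]

theorem integral_kernel_mul_comm [SecondCountableTopology X] (hk : Continuous k) (hks : ∀ x y, k (x, y) = k (y, x))
    {f g : X → ℝ} (hf : Integrable f μ) (hg : Integrable g μ) :
    ∫ x, (∫ y, f y * k (x, y) ∂μ) * g x ∂μ = ∫ x, f x * (∫ y, g y * k (x, y) ∂μ) ∂μ := by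
  obtain ⟨C, hC⟩ := isCompact_univ.exists_bound_of_continuousOn hk.continuousOn
  have hint : Integrable (fun q : X × X => g q.1 * f q.2 * k q) (μ.prod μ) :=
    (hg.mul_prod hf).mul_bdd (c := C) hk.aestronglyMeasurable
      (Eventually.of_forall fun q => hC q (mem_univ q))
  have hswap := integral_integral_swap (f := fun x y => g x * f y * k (x, y)) hint
  calc ∫ x, (∫ y, f y * k (x, y) ∂μ) * g x ∂μ = ∫ x, ∫ y, g x * f y * k (x, y) ∂μ ∂μ := by
        refine integral_congr_ae (Eventually.of_forall fun x => ?_)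
        simp only
        rw [← integral_mul_const]
        exact integral_congr_ae (Eventually.of_forall fun y => by ring_nf)
    _ = ∫ y, ∫ x, g x * f y * k (x, y) ∂μ ∂μ := hswap
    _ = ∫ x, f x * (∫ y, g y * k (x, y) ∂μ) ∂μ := by
        refine integral_congr_ae (Eventually.of_forall fun y => ?_)
        simp only
        rw [← integral_const_mul]
        refine integral_congr_ae (Eventually.of_forall fun x => ?_)
        simp only
        rw [hks x y]; ring

end

/-! ### The Poisson kernel -/

section

variable {d : ℕ} {Ω : Set (EuclideanSpace ℝ (Fin d))} [CompactSpace Ω]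
  {μ : Measure Ω} [IsProbabilityMeasure μ]

/-- The Poisson kernel `∑ P_n(x, y) r^n`. -/
def poissonKernel (μ : Measure Ω) [IsFiniteMeasure μ] (r : ℝ) (p : Ω × Ω) : ℝ :=
  ∑' n, reproKernel μ n p.1 p.2 * r ^ n

theorem continuous_jacobiZ (α β : ℝ) (n : ℕ) : Continuous (jacobiZ α β n) := by
  unfold jacobiZ jacobiP
  fun_prop

/-- The consequences of the addition formula for the growth and positivity of the kernels. -/
theorem AdditionFormula.exists_bound (hadd : AdditionFormula μ) :
    ∃ B : ℕ → ℝ, (∀ r ∈ Ico (0 : ℝ) 1, Summable fun n => B n * r ^ n) ∧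
      (∀ n x y, |reproKernel μ n x y| ≤ B n) ∧
      ∀ r ∈ Ico (0 : ℝ) 1, ∀ p, 0 ≤ poissonKernel μ r p := by
  obtain ⟨α, β, hβ, hαβ, m, -, τ, ξ, hτ, -, hmem, hmeas, hP⟩ := hadd
  refine ⟨fun n => jacobiZ α β n 1, fun r hr => summable_jacobiZ_one hβ hαβ hr, fun n x y => ?_,
    fun r hr p => ?_⟩
  · rw [hP]
    have := norm_integral_le_of_norm_le_const (μ := τ) (C := jacobiZ α β n 1)
      (f := fun u => jacobiZ α β n (ξ x y u))
      (Eventually.of_forall fun u => abs_jacobiZ_le hβ hαβ n (hmem x y u))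
    simpa using this
  · have hbound : ∀ n u, ‖jacobiZ α β n (ξ p.1 p.2 u) * r ^ n‖ ≤ jacobiZ α β n 1 * r ^ n :=
      fun n u => by
        rw [norm_mul, norm_pow, Real.norm_of_nonneg hr.1]
        exact mul_le_mul_of_nonneg_right (abs_jacobiZ_le hβ hαβ n (hmem _ _ u)) (pow_nonneg hr.1 n)
    have hint : ∀ n, Integrable (fun u => jacobiZ α β n (ξ p.1 p.2 u) * r ^ n) τ := fun n =>
      Integrable.of_bound (((continuous_jacobiZ α β n).measurable.comp_aemeasurable
        (hmeas p.1 p.2)).mul_const _).aestronglyMeasurable _ (Eventually.of_forall (hbound n))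
    have hsum : Summable fun n => ∫ u, ‖jacobiZ α β n (ξ p.1 p.2 u) * r ^ n‖ ∂τ := by
      refine Summable.of_nonneg_of_le (fun n => integral_nonneg fun u => norm_nonneg _)
        (fun n => ?_) (summable_jacobiZ_one hβ hαβ hr)
      have := integral_mono (hint n).norm (integrable_const _) (hbound n)
      simpa using this
    -- Exchanging sum and integral writes the Poisson kernel as a `τ`-average of the nonnegative
    -- sums `∑ Z_n(ξ) r^n`.
    have h := integral_tsum_of_summable_integral_norm hint hsum
    rw [poissonKernel]
    simp only [hP, ← integral_mul_const]
    rw [h]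
    exact integral_nonneg fun u => tsum_jacobiZ_nonneg hβ hαβ (hmem _ _ u) hr

variable {B : ℕ → ℝ} {r : ℝ}

theorem continuous_poissonKernel (hB : Summable fun n => B n * r ^ n) (hr : 0 ≤ r)
    (hP : ∀ n x y, |reproKernel μ n x y| ≤ B n) : Continuous (poissonKernel μ r) := by
  refine continuous_tsum (fun n => (continuous_reproKernel μ n).mul continuous_const) hB
    fun n p => ?_
  rw [norm_mul, norm_pow, Real.norm_of_nonneg hr]
  exact mul_le_mul_of_nonneg_right (hP _ _ _) (pow_nonneg hr n)

theorem poissonKernel_comm (x y : Ω) : poissonKernel μ r (x, y) = poissonKernel μ r (y, x) :=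
  tsum_congr fun n => by rw [reproKernel_comm]

theorem norm_projOp_mul_pow_le (hr : 0 ≤ r)
    (hP : ∀ n x y, |reproKernel μ n x y| ≤ B n) {f : Ω → ℝ} (hf : Integrable f μ) (n : ℕ) (x : Ω) :
    ‖projOp μ n f x * r ^ n‖ ≤ (∫ y, ‖f y‖ ∂μ) * (B n * r ^ n) := by
  rw [norm_mul, norm_pow, Real.norm_of_nonneg hr, ← mul_assoc, ← integral_mul_const]
  refine mul_le_mul_of_nonneg_right ?_ (pow_nonneg hr n)
  refine norm_integral_le_of_norm_le (hf.norm.mul_const _) (Eventually.of_forall fun y => ?_)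
  rw [norm_mul]
  exact mul_le_mul_of_nonneg_left (hP _ _ _) (norm_nonneg _)

theorem summable_projOp (hB : Summable fun n => B n * r ^ n) (hr : 0 ≤ r)
    (hP : ∀ n x y, |reproKernel μ n x y| ≤ B n) {f : Ω → ℝ} (hf : Integrable f μ) (x : Ω) :
    Summable fun n => projOp μ n f x * r ^ n :=
  Summable.of_norm_bounded (hB.mul_left _) fun n => norm_projOp_mul_pow_le hr hP hf n x

theorem continuous_poissonInt (hB : Summable fun n => B n * r ^ n) (hr : 0 ≤ r)
    (hP : ∀ n x y, |reproKernel μ n x y| ≤ B n) {f : Ω → ℝ} (hf : Integrable f μ) :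
    Continuous (poissonInt μ r f) :=
  continuous_tsum (fun n => (continuous_projOp μ n hf).mul continuous_const) (hB.mul_left _)
    fun n x => norm_projOp_mul_pow_le hr hP hf n x

theorem poissonInt_eq_integral (hB : Summable fun n => B n * r ^ n) (hr : 0 ≤ r)
    (hP : ∀ n x y, |reproKernel μ n x y| ≤ B n) {f : Ω → ℝ} (hf : Integrable f μ) (x : Ω) :
    poissonInt μ r f x = ∫ y, f y * poissonKernel μ r (x, y) ∂μ := by
  have hc : ∀ n, Continuous fun y => reproKernel μ n x y := fun n =>
    (continuous_reproKernel μ n).comp (by fun_prop : Continuous fun y : Ω => (x, y))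
  have hint : ∀ n, Integrable (fun y => f y * reproKernel μ n x y * r ^ n) μ := fun n =>
    (integrable_mul_cont μ hf ⟨_, hc n⟩).mul_const _
  have hbd : ∀ n y, ‖f y * reproKernel μ n x y * r ^ n‖ ≤ ‖f y‖ * (B n * r ^ n) := fun n y => by
    rw [norm_mul, norm_mul, norm_pow, Real.norm_of_nonneg hr, mul_assoc]
    exact mul_le_mul_of_nonneg_left (mul_le_mul_of_nonneg_right (hP _ _ _) (pow_nonneg hr n))
      (norm_nonneg _)
  have hsum : Summable fun n => ∫ y, ‖f y * reproKernel μ n x y * r ^ n‖ ∂μ := by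
    refine Summable.of_nonneg_of_le (fun n => integral_nonneg fun u => norm_nonneg _)
      (fun n => ?_) (hB.mul_left (∫ y, ‖f y‖ ∂μ))
    rw [← integral_mul_const]
    exact integral_mono (hint n).norm (hf.norm.mul_const _) (hbd n)
  have h := integral_tsum_of_summable_integral_norm hint hsum
  rw [poissonInt]
  simp only [projOp, ← integral_mul_const]
  rw [h]
  refine integral_congr_ae (Eventually.of_forall fun y => ?_)
  simp only [poissonKernel]
  rw [← tsum_mul_left]
  exact tsum_congr fun n => by ring

end

section

variable {d : ℕ} {Ω : Set (EuclideanSpace ℝ (Fin d))} [CompactSpace Ω]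
  {μ : Measure Ω} [IsProbabilityMeasure μ]

/-! ### Properties of the Poisson integral -/

theorem integral_poissonKernel (hinner : IsInnerOnPoly μ) {B : ℕ → ℝ} {r : ℝ}
    (hB : Summable fun n => B n * r ^ n) (hr : 0 ≤ r)
    (hP : ∀ n x y, |reproKernel μ n x y| ≤ B n) (x : Ω) :
    ∫ y, poissonKernel μ r (x, y) ∂μ = 1 := by
  have h := poissonInt_eq_integral hB hr hP (integrable_const (1 : ℝ)) x
  simp only [one_mul] at h
  rw [← h, poissonInt_one μ hinner]

/-- The Poisson kernel is a continuous, nonnegative and symmetric kernel of total mass one which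
represents the Poisson integral. -/
structure PoissonKernelFacts (μ : Measure Ω) [IsProbabilityMeasure μ] (r : ℝ) : Prop where
  continuous : Continuous (poissonKernel μ r)
  nonneg : ∀ p, 0 ≤ poissonKernel μ r p
  integral_eq_one : ∀ x, ∫ y, poissonKernel μ r (x, y) ∂μ = 1
  summable : ∀ f : Ω → ℝ, Integrable f μ → ∀ x, Summable fun n => projOp μ n f x * r ^ n
  continuous_int : ∀ f : Ω → ℝ, Integrable f μ → Continuous (poissonInt μ r f)
  eq_integral : ∀ f : Ω → ℝ, Integrable f μ → ∀ x,
    poissonInt μ r f x = ∫ y, f y * poissonKernel μ r (x, y) ∂μ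

theorem AdditionFormula.poissonKernelFacts (hadd : AdditionFormula μ) (hinner : IsInnerOnPoly μ)
    {r : ℝ} (hr : r ∈ Ico (0 : ℝ) 1) : PoissonKernelFacts μ r := by
  obtain ⟨B, hB, hP, hpos⟩ := hadd.exists_bound
  exact ⟨continuous_poissonKernel (hB r hr) hr.1 hP, hpos r hr,
    integral_poissonKernel hinner (hB r hr) hr.1 hP,
    fun f hf => summable_projOp (hB r hr) hr.1 hP hf,
    fun f hf => continuous_poissonInt (hB r hr) hr.1 hP hf,
    fun f hf => poissonInt_eq_integral (hB r hr) hr.1 hP hf⟩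

namespace PoissonKernelFacts

variable {r : ℝ}

theorem poissonInt_nonneg (H : PoissonKernelFacts μ r) {f : Ω → ℝ} (hf : Integrable f μ)
    (hf0 : ∀ᵐ x ∂μ, 0 ≤ f x) (x : Ω) : 0 ≤ poissonInt μ r f x := by
  rw [H.eq_integral f hf]
  exact integral_nonneg_of_ae (hf0.mono fun y hy => mul_nonneg hy (H.nonneg _))

theorem eLpNorm_le (H : PoissonKernelFacts μ r) {p : ℝ≥0∞} (hp : 1 ≤ p) {f : Ω → ℝ}
    (hf : MemLp f p μ) : eLpNorm (poissonInt μ r f) p μ ≤ eLpNorm f p μ := by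
  rw [show poissonInt μ r f = _ from funext (H.eq_integral f (hf.integrable hp))]
  exact eLpNorm_integral_kernel_le H.continuous H.nonneg poissonKernel_comm H.integral_eq_one hp
    hf.aestronglyMeasurable

theorem memLp (H : PoissonKernelFacts μ r) {p : ℝ≥0∞} (hp : 1 ≤ p) {f : Ω → ℝ}
    (hf : MemLp f p μ) : MemLp (poissonInt μ r f) p μ :=
  ⟨(H.continuous_int f (hf.integrable hp)).aestronglyMeasurable,
    (H.eLpNorm_le hp hf).trans_lt hf.eLpNorm_lt_top⟩

/-- Makes the operator well defined on `L²` classes, whose sums and multiples are computed only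
almost everywhere. -/
theorem poissonInt_congr (H : PoissonKernelFacts μ r) {f g : Ω → ℝ} (hf : Integrable f μ)
    (h : f =ᵐ[μ] g) : poissonInt μ r f = poissonInt μ r g := by
  ext x
  rw [H.eq_integral f hf, H.eq_integral g (hf.congr h)]
  exact integral_congr_ae (h.mono fun y hy => by simp only [hy])

theorem poissonInt_add (H : PoissonKernelFacts μ r) {f g : Ω → ℝ} (hf : Integrable f μ)
    (hg : Integrable g μ) (x : Ω) :
    poissonInt μ r (f + g) x = poissonInt μ r f x + poissonInt μ r g x := by
  rw [H.eq_integral f hf, H.eq_integral g hg, H.eq_integral _ (hf.add hg),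
    ← integral_add (integrable_mul_kernel H.continuous hf x)
      (integrable_mul_kernel H.continuous hg x)]
  simp only [Pi.add_apply, add_mul]

theorem poissonInt_smul (H : PoissonKernelFacts μ r) (c : ℝ) {f : Ω → ℝ} (hf : Integrable f μ)
    (x : Ω) : poissonInt μ r (c • f) x = c * poissonInt μ r f x := by
  rw [H.eq_integral f hf, H.eq_integral _ (hf.smul c), ← integral_const_mul]
  simp only [Pi.smul_apply, smul_eq_mul, mul_assoc]

theorem poissonInt_sub (H : PoissonKernelFacts μ r) {f g : Ω → ℝ} (hf : Integrable f μ)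
    (hg : Integrable g μ) (x : Ω) :
    poissonInt μ r (f - g) x = poissonInt μ r f x - poissonInt μ r g x := by
  have h := H.poissonInt_add (hf.sub hg) hg x
  rw [sub_add_cancel] at h
  linarith

theorem norm_le (H : PoissonKernelFacts μ r) (f : C(Ω, ℝ)) (x : Ω) :
    |poissonInt μ r f x| ≤ ‖f‖ := by
  rw [H.eq_integral f (integrable_cont μ f)]
  have hk : Integrable (fun y => ‖f‖ * poissonKernel μ r (x, y)) μ :=
    integrable_mul_kernel H.continuous (integrable_const _) x
  have h : ‖∫ y, f y * poissonKernel μ r (x, y) ∂μ‖ ≤ ∫ y, ‖f‖ * poissonKernel μ r (x, y) ∂μ := by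
    refine norm_integral_le_of_norm_le hk (Eventually.of_forall fun y => ?_)
    rw [norm_mul, Real.norm_of_nonneg (H.nonneg _)]
    exact mul_le_mul_of_nonneg_right (f.norm_coe_le_norm y) (H.nonneg _)
  rwa [integral_const_mul, H.integral_eq_one, mul_one] at h

/-- The Poisson integral as a bounded operator on `L²`. -/
def toL2 (H : PoissonKernelFacts μ r) : Lp ℝ 2 μ →L[ℝ] Lp ℝ 2 μ :=
  LinearMap.mkContinuous
    { toFun := fun f => (H.memLp one_le_two (Lp.memLp f)).toLp (poissonInt μ r f)
      map_add' := fun f g => by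
        rw [← MemLp.toLp_add]
        refine MemLp.toLp_congr _ _ (Eventually.of_forall fun x => ?_)
        have hf := (Lp.memLp f).integrable one_le_two
        have hg := (Lp.memLp g).integrable one_le_two
        rw [H.poissonInt_congr ((Lp.memLp (f + g)).integrable one_le_two) (Lp.coeFn_add f g)]
        exact H.poissonInt_add hf hg x
      map_smul' := fun c f => by
        rw [RingHom.id_apply, ← MemLp.toLp_const_smul]
        refine MemLp.toLp_congr _ _ (Eventually.of_forall fun x => ?_)
        have hf := (Lp.memLp f).integrable one_le_two
        rw [H.poissonInt_congr ((Lp.memLp (c • f)).integrable one_le_two) (Lp.coeFn_smul c f)]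
        exact H.poissonInt_smul c hf x } 1 fun f => by
    rw [one_mul, Lp.norm_def f]
    simp only [LinearMap.coe_mk, AddHom.coe_mk, Lp.norm_toLp]
    exact ENNReal.toReal_mono (Lp.eLpNorm_ne_top f) (H.eLpNorm_le one_le_two (Lp.memLp f))

theorem toL2_ae_eq (H : PoissonKernelFacts μ r) (f : Lp ℝ 2 μ) :
    H.toL2 f =ᵐ[μ] poissonInt μ r f :=
  MemLp.coeFn_toLp (H.memLp one_le_two (Lp.memLp f))

theorem isSelfAdjoint_toL2 (H : PoissonKernelFacts μ r) : IsSelfAdjoint H.toL2 := by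
  rw [ContinuousLinearMap.isSelfAdjoint_iff_isSymmetric]
  intro f g
  have hf := (Lp.memLp f).integrable one_le_two
  have hg := (Lp.memLp g).integrable one_le_two
  have h := integral_kernel_mul_comm H.continuous poissonKernel_comm hf hg
  simp only [← H.eq_integral _ hf, ← H.eq_integral _ hg] at h
  change inner ℝ (H.toL2 f) g = inner ℝ f (H.toL2 g)
  rw [L2.inner_def, L2.inner_def]
  refine Eq.trans ?_ (h.trans ?_)
  · refine integral_congr_ae ((H.toL2_ae_eq f).mono fun x hx => ?_)
    simp [hx, mul_comm]
  · refine integral_congr_ae ((H.toL2_ae_eq g).mono fun x hx => ?_)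
    simp [hx, mul_comm]

end PoissonKernelFacts

/-- Approximate `f` by a polynomial within `ε/3`; the sup-norm contraction bounds the error after
applying the Poisson integral by the same amount, uniformly in `r`. -/
theorem AdditionFormula.tendstoUniformly (hadd : AdditionFormula μ) (hinner : IsInnerOnPoly μ)
    (f : C(Ω, ℝ)) :
    TendstoUniformly (fun (r : ℝ) (x : Ω) => poissonInt μ r f x) f (𝓝[<] 1) := by
  rw [Metric.tendstoUniformly_iff]
  intro ε hε
  obtain ⟨N, p, hp, hpf⟩ := exists_polySpace_near f (show 0 < ε / 3 by positivity)
  have hunif := Metric.tendstoUniformly_iff.1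
    (tendstoUniformly_poissonInt_of_mem_polySpace μ hinner hp) (ε / 3) (by positivity)
  filter_upwards [hunif, Ioo_mem_nhdsLT (show (0 : ℝ) < 1 by norm_num)] with r hr hr01 x
  have H := hadd.poissonKernelFacts hinner (r := r) ⟨hr01.1.le, hr01.2⟩
  have h1 := H.norm_le (p - f) x
  have h2 := H.poissonInt_sub (integrable_cont μ p) (integrable_cont μ f) x
  have h3 := hr x
  have h4 := (p - f).norm_coe_le_norm x
  rw [Real.dist_eq] at h3 ⊢
  rw [ContinuousMap.coe_sub, h2] at h1
  rw [ContinuousMap.sub_apply, Real.norm_eq_abs] at h4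
  have e : f x - poissonInt μ r f x = -(p x - f x) + (p x - poissonInt μ r p x) +
    (poissonInt μ r p x - poissonInt μ r f x) := by ring
  rw [e]
  refine (abs_add_three _ _ _).trans_lt ?_
  rw [abs_neg]
  linarith

theorem AdditionFormula.tendsto_eLpNorm (hadd : AdditionFormula μ) (hinner : IsInnerOnPoly μ)
    {p : ℝ≥0∞} (hp : 1 ≤ p) (hpt : p ≠ ∞) {f : Ω → ℝ} (hf : MemLp f p μ) :
    Tendsto (fun r : ℝ => eLpNorm (fun x => poissonInt μ r f x - f x) p μ) (𝓝[<] 1) (𝓝 0) := by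
  rw [ENNReal.tendsto_nhds_zero]
  intro ε hε
  obtain ⟨δ, hδ, hδε⟩ : ∃ δ : ℝ, 0 < δ ∧ ENNReal.ofReal δ ≤ ε / 3 := by
    have h3 : ε / 3 ≠ 0 := (ENNReal.div_pos hε.ne' (by norm_num)).ne'
    obtain ⟨q, hq, hq'⟩ := ENNReal.lt_iff_exists_nnreal_btwn.1 (pos_iff_ne_zero.2 h3)
    exact ⟨q, by simpa using hq, by simpa using hq'.le⟩
  -- Continuous functions are dense since `p` is finite; for `g` the uniform convergence is already
  -- known.
  obtain ⟨g, hfg, hg⟩ := hf.exists_boundedContinuous_eLpNorm_sub_le hpt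
    (ENNReal.ofReal_pos.2 hδ).ne'
  have hunif := Metric.tendstoUniformly_iff.1
    (hadd.tendstoUniformly hinner g.toContinuousMap) δ hδ
  filter_upwards [hunif, Ioo_mem_nhdsLT (show (0 : ℝ) < 1 by norm_num)] with r hr hr01
  have H := hadd.poissonKernelFacts hinner (r := r) ⟨hr01.1.le, hr01.2⟩
  have hfi := hf.integrable hp
  have hgi := hg.integrable hp
  have hsub : MemLp (f - ⇑g) p μ := hf.sub hg
  have hQg := H.memLp hp hg
  have e : (fun x => poissonInt μ r f x - f x) =
      poissonInt μ r (f - ⇑g) + ((poissonInt μ r g - ⇑g) - (f - ⇑g)) := by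
    ext x
    simp only [Pi.add_apply, Pi.sub_apply, H.poissonInt_sub hfi hgi]
    ring
  rw [e]
  -- A uniform bound is an `L^p` bound with the same constant because `μ` has total mass one.
  have h1 : eLpNorm (poissonInt μ r g - ⇑g) p μ ≤ ENNReal.ofReal δ := by
    have := eLpNorm_le_of_ae_bound (μ := μ) (p := p) (f := poissonInt μ r g - ⇑g) (C := δ)
      (Eventually.of_forall fun x => by
        have := (hr x).le
        rw [dist_comm, Real.dist_eq] at this
        exact this)
    simpa using this
  calc _ ≤ eLpNorm (poissonInt μ r (f - ⇑g)) p μ +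
        eLpNorm ((poissonInt μ r g - ⇑g) - (f - ⇑g)) p μ :=
        eLpNorm_add_le (H.memLp hp hsub).1 ((hQg.sub hg).sub hsub).1 hp
    _ ≤ eLpNorm (poissonInt μ r (f - ⇑g)) p μ +
        (eLpNorm (poissonInt μ r g - ⇑g) p μ + eLpNorm (f - ⇑g) p μ) := by
        gcongr
        exact eLpNorm_sub_le (hQg.sub hg).1 hsub.1 hp
    _ ≤ ε / 3 + (ε / 3 + ε / 3) := by
        gcongr
        · exact (H.eLpNorm_le hp hsub).trans (hfg.trans hδε)
        · exact h1.trans hδε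
        · exact hfg.trans hδε
    _ = ε := by rw [← add_assoc, ENNReal.add_thirds]

end

end PoissonAdd

end

theorem mainTheorem10 {d : ℕ} (Ω : Set (EuclideanSpace ℝ (Fin d))) [CompactSpace Ω]
    (m : Measure Ω) (w : Ω → ℝ) (hw_nonneg : ∀ x, 0 ≤ w x) (hw_meas : Measurable w)
    [IsProbabilityMeasure (weightMeasure m w)]
    (hinner : IsInnerOnPoly (weightMeasure m w))
    (hadd : AdditionFormula (weightMeasure m w)) :
    -- the series defining `Q_r f` converges absolutely everywhere on `Ω`
    (∀ f : Ω → ℝ, Integrable f (weightMeasure m w) → ∀ r ∈ Ico (0 : ℝ) 1, ∀ x,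
      Summable fun n : ℕ => projOp (weightMeasure m w) n f x * r ^ n) ∧
    -- (1) constants are reproduced
    (∀ r ∈ Ico (0 : ℝ) 1, ∀ x, poissonInt (weightMeasure m w) r (fun _ => 1) x = 1) ∧
    -- (2) positivity
    (∀ r ∈ Ico (0 : ℝ) 1, ∀ f : Ω → ℝ, Integrable f (weightMeasure m w) →
      (∀ᵐ x ∂(weightMeasure m w), 0 ≤ f x) → ∀ x, 0 ≤ poissonInt (weightMeasure m w) r f x) ∧
    -- (3) `Q_r` is a self-adjoint operator on `L²`
    (∀ r ∈ Ico (0 : ℝ) 1,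
      ∃ T : Lp ℝ 2 (weightMeasure m w) →L[ℝ] Lp ℝ 2 (weightMeasure m w), IsSelfAdjoint T ∧
        ∀ f : Lp ℝ 2 (weightMeasure m w),
          T f =ᵐ[weightMeasure m w] poissonInt (weightMeasure m w) r f) ∧
    -- (4) contraction on every `L^p`, and on `C(Ω)` with the uniform norm
    (∀ r ∈ Ico (0 : ℝ) 1, ∀ p : ℝ≥0∞, 1 ≤ p → ∀ f : Ω → ℝ, MemLp f p (weightMeasure m w) →
      MemLp (poissonInt (weightMeasure m w) r f) p (weightMeasure m w) ∧
      eLpNorm (poissonInt (weightMeasure m w) r f) p (weightMeasure m w) ≤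
        eLpNorm f p (weightMeasure m w)) ∧
    (∀ r ∈ Ico (0 : ℝ) 1, ∀ f : C(Ω, ℝ), ∃ g : C(Ω, ℝ),
      (∀ x, g x = poissonInt (weightMeasure m w) r f x) ∧ ‖g‖ ≤ ‖f‖) ∧
    -- (5) convergence as `r → 1-` in `L^p`, `1 ≤ p < ∞`, and uniformly for continuous functions
    (∀ p : ℝ≥0∞, 1 ≤ p → p ≠ ∞ → ∀ f : Ω → ℝ, MemLp f p (weightMeasure m w) →
      Tendsto (fun r : ℝ =>
          eLpNorm (fun x => poissonInt (weightMeasure m w) r f x - f x) p (weightMeasure m w))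
        (𝓝[<] 1) (𝓝 0)) ∧
    (∀ f : C(Ω, ℝ),
      TendstoUniformly (fun (r : ℝ) (x : Ω) => poissonInt (weightMeasure m w) r f x) f
        (𝓝[<] 1)) := by
  set μ := weightMeasure m w
  have H : ∀ r ∈ Ico (0 : ℝ) 1, PoissonKernelFacts μ r :=
    fun r hr => hadd.poissonKernelFacts hinner hr
  refine ⟨fun f hf r hr x => (H r hr).summable f hf x, fun r _ x => poissonInt_one μ hinner r x,
    fun r hr f hf hf0 x => (H r hr).poissonInt_nonneg hf hf0 x,
    fun r hr => ⟨(H r hr).toL2, (H r hr).isSelfAdjoint_toL2, (H r hr).toL2_ae_eq⟩,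
    fun r hr p hp f hf => ⟨(H r hr).memLp hp hf, (H r hr).eLpNorm_le hp hf⟩,
    fun r hr f => ⟨⟨_, (H r hr).continuous_int f (integrable_cont μ f)⟩, fun x => rfl, ?_⟩,
    fun p hp hpt f hf => hadd.tendsto_eLpNorm hinner hp hpt hf, hadd.tendstoUniformly hinner⟩
  exact (ContinuousMap.norm_le _ (norm_nonneg f)).2 fun x => (H r hr).norm_le f x
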